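/- For $\alpha\in\mathbb R$ let $\varphi_\alpha$ be the Kronecker flow on the torus $T^2=(\mathbb R/\mathbb Z)^2$ given by $$\varphi_\alpha^t(x,y)=(x+\alpha t,\;y+t).$$ A $C^\infty$ flow is called locally free if the isotropy group in $\mathbb R$ of every point is discrete; its orbits are then the leaves of its orbit foliation. A locally free $C^\infty$ flow $\varphi$ on a closed manifold $M$ is called \emph{parameter rigid} if for every locally free $C^\infty$ flow $\psi$ on $M$ with the same orbit foliation (that is, with the same orbits) as $\varphi$, there exist a $C^\infty$ diffeomorphism $F$ of $M$ that maps each orbit of $\varphi$ onto itself and an automorphism $A$ of the Lie group $\mathbb R$ (that is, $A(t)=ct$ with $c\neq0$) such that $$F(\varphi^t(x))=\psi^{A(t)}(F(x))\qquad\text{for all }x\in M,\ t\in\mathbb R.$$ A real number $\alpha$ is called \emph{badly approximable} here if there exist $C>0$ and $\rho>0$ such that $$\Vert k\alpha\Vert_{\mathbb R/\mathbb Z}>C|k|^{-\rho}\qquad\text{for all }k\in\mathbb Z\setminus\{0\},$$ where $\Vert\cdot\Vert_{\mathbb R/\mathbb Z}$ denotes the distance to $0$ in $\mathbb R/\mathbb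 Z$ (equivalently, the distance to the nearest integer). Then, for every $\alpha\in\mathbb R$, the Kronecker flow $\varphi_\alpha$ is parameter rigid if and only if $\alpha$ is badly approximable. -/

import Mathlib

open scoped Manifold ContDiff Topology

/-- A locally free `C^∞` flow on a manifold `M`: a `C^∞` action of `ℝ` on `M` all of whose isotropy
groups `{t | φ t x = x}` are discrete subgroups of `ℝ`, that is, have `0` as an isolated point. -/
structure SmoothLocallyFreeFlow {E H : Type*} [NormedAddCommGroup E] [NormedSpace ℝ E]
    [TopologicalSpace H] (I : ModelWithCorners ℝ E H) (M : Type*) [TopologicalSpace M]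
    [ChartedSpace H M] extends Flow ℝ M where
  contMDiff' : ContMDiff (𝓘(ℝ, ℝ).prod I) I ∞ (fun p : ℝ × M => toFun p.1 p.2)
  locallyFree' : ∀ x : M, ∀ᶠ t in 𝓝[≠] (0 : ℝ), toFun t x ≠ x

/-- `φ` is parameter rigid if every locally free `C^∞` flow `ψ` with the same orbit foliation is
conjugate to `φ` by a `C^∞` diffeomorphism `F` preserving every leaf, up to an automorphism `A` of
the Lie group `ℝ` (Lie group automorphisms are the bicontinuous group automorphisms). -/
def SmoothLocallyFreeFlow.IsParameterRigid {E H : Type*} [NormedAddCommGroup E] [NormedSpace ℝ E]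
    [TopologicalSpace H] {I : ModelWithCorners ℝ E H} {M : Type*} [TopologicalSpace M]
    [ChartedSpace H M] (φ : SmoothLocallyFreeFlow I M) : Prop :=
  ∀ ψ : SmoothLocallyFreeFlow I M, (∀ x, ψ.toFlow.orbit x = φ.toFlow.orbit x) →
    ∃ (F : M ≃ₘ⟮I, I⟯ M) (A : ℝ ≃ₜ+ ℝ),
      (∀ x, F '' φ.toFlow.orbit x = φ.toFlow.orbit x) ∧
      ∀ (x : M) (t : ℝ), F (φ.toFlow t x) = ψ.toFlow (A t) (F x)

/-- `t ↦ exp (2 π i t)`, which identifies `ℝ / ℤ` with the unit circle. -/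
noncomputable def circlePoint (t : ℝ) : Circle := Circle.exp (2 * Real.pi * t)

theorem circlePoint_zero : circlePoint 0 = 1 := by simp [circlePoint]

theorem circlePoint_add (s t : ℝ) : circlePoint (s + t) = circlePoint s * circlePoint t := by
  simp [circlePoint, mul_add, Circle.exp_add]

theorem contMDiff_circlePoint : ContMDiff 𝓘(ℝ, ℝ) (𝓡 1) ∞ circlePoint :=
  contMDiff_circleExp.comp (contDiff_const.mul contDiff_id).contMDiff

theorem eventually_circlePoint_ne_one : ∀ᶠ t in 𝓝[≠] (0 : ℝ), circlePoint t ≠ 1 := by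
  have h : ∀ᶠ t in 𝓝[≠] (0 : ℝ), t ∈ Metric.ball (0 : ℝ) 1 :=
    nhdsWithin_le_nhds (Metric.ball_mem_nhds 0 one_pos)
  filter_upwards [h, self_mem_nhdsWithin] with t ht ht0 h1
  obtain ⟨n, hn⟩ := Circle.exp_eq_one.mp h1
  have hp := Real.pi_pos
  have htn : t = n := by
    have : 2 * Real.pi * (t - n) = 0 := by linarith
    rcases mul_eq_zero.mp this with h | h
    · linarith
    · linarith
  rw [htn, mem_ball_zero_iff, Real.norm_eq_abs] at ht
  have : |n| < 1 := by exact_mod_cast ht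
  rw [Int.abs_lt_one_iff] at this
  exact ht0 (by simp [htn, this])

/-- The Kronecker flow `(x, y) ↦ (x + α t, y + t)` on the torus `T² = S¹ × S¹`, the circle
`S¹ = ℝ / ℤ` being the unit circle in `ℂ` with its multiplication. -/
noncomputable def kroneckerFlow (α : ℝ) :
    SmoothLocallyFreeFlow ((𝓡 1).prod (𝓡 1)) (Circle × Circle) where
  toFun t p := (p.1 * circlePoint (α * t), p.2 * circlePoint t)
  cont' := by
    have := contMDiff_circlePoint.continuous
    simp only [Function.uncurry_def]
    fun_prop
  map_add' s t p := by
    simp only [mul_add, circlePoint_add, mul_assoc, mul_comm (circlePoint (α * s)),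
      mul_comm (circlePoint s)]
  map_zero' p := by simp [circlePoint_zero]
  contMDiff' := by
    refine ContMDiff.prodMk ?_ ?_
    · exact (contMDiff_fst.comp contMDiff_snd).mul
        (contMDiff_circlePoint.comp
          ((contDiff_const.mul contDiff_id).contMDiff.comp contMDiff_fst))
    · exact (contMDiff_snd.comp contMDiff_snd).mul (contMDiff_circlePoint.comp contMDiff_fst)
  locallyFree' p := by
    filter_upwards [eventually_circlePoint_ne_one] with t ht h
    exact ht (mul_eq_left.mp (Prod.ext_iff.mp h).2)

/-- `α` is badly approximable (in the polynomial Diophantine sense): there are `C, ρ > 0` with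
`‖k α‖ > C |k| ^ (-ρ)` for all nonzero integers `k`, where `‖·‖` is the distance to `0` in
`ℝ / ℤ`. -/
def IsBadlyApproximable (α : ℝ) : Prop :=
  ∃ C > (0 : ℝ), ∃ ρ > (0 : ℝ), ∀ k : ℤ, k ≠ 0 →
    ‖((k * α : ℝ) : UnitAddCircle)‖ > C * |(k : ℝ)| ^ (-ρ)

/-! If `ψ` has the orbits of an irrational Kronecker flow `φ`, the `ψ`-time `σ (z, t)` needed to
follow `φ` for time `t` is a smooth cocycle over `φ`. A leaf-preserving conjugacy exists when `σ (z,
t)` is `c * t` plus a coboundary. On the circle `y = 0` the time-one map of `φ` is the rotation by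
`α`, so the question becomes the cohomological equation `u (x + α) - u x = w x - c`, with `w` the
`ψ`-time of one return. In Fourier coefficients this means dividing by `exp (2πikα) - 1`, which is
small when `‖kα‖` is.

If `α` is badly approximable, the division costs only a power of `k`, so rapid decay survives and
the solution is smooth (`exists_contDiff_cohomological`). Extending it along the leaves
(`exists_transfer_function`) gives `u` on the torus, and `p ↦ ψ^{-u(p)}(p)` is the conjugacy.

If `α` is rational, all orbits of `φ` have a common period; slowing each orbit by its own factor
destroys this. If `α` is irrational but not badly approximable, there are `k j` with `ε j = k j * α
- m j` smaller than every power of `k j`. The derivative along the flow of the divergent sum of `cos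
(2π (k j * x - m j * y))` is then a smooth function, and the time change it generates
(`exists_flow_of_generator`) could be conjugate to `φ` only through a continuous `u` whose
coefficients at all `k j` equal `1 / 2`, against the Riemann–Lebesgue lemma
(`no_continuous_transfer`). -/

/-! ### The covering `ℝ² → T²` and lifts through it. -/

theorem circlePoint_eq_one_iff {t : ℝ} : circlePoint t = 1 ↔ ∃ n : ℤ, t = n := by
  have hp := Real.pi_pos
  rw [circlePoint, Circle.exp_eq_one]
  refine exists_congr fun n => ⟨fun h => ?_, fun h => by rw [h]; ring⟩
  have : 2 * Real.pi * (t - n) = 0 := by linarith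
  rcases mul_eq_zero.mp this with h | h <;> linarith

theorem circlePoint_neg (t : ℝ) : circlePoint (-t) = (circlePoint t)⁻¹ := by
  rw [eq_inv_iff_mul_eq_one, ← circlePoint_add, neg_add_cancel, circlePoint_zero]

theorem circlePoint_sub (s t : ℝ) : circlePoint (s - t) = circlePoint s / circlePoint t := by
  rw [sub_eq_add_neg, circlePoint_add, circlePoint_neg, div_eq_mul_inv]

theorem circlePoint_eq_iff {s t : ℝ} : circlePoint s = circlePoint t ↔ ∃ n : ℤ, s = t + n := by
  rw [← div_eq_one, ← circlePoint_sub, circlePoint_eq_one_iff]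
  exact exists_congr fun n => sub_eq_iff_eq_add'

theorem continuous_circlePoint : Continuous circlePoint :=
  contMDiff_circlePoint.continuous

/-- The inverse of `circlePoint` with values in `(-1/2, 1/2]`. -/
noncomputable def circleAngle (z : Circle) : ℝ := Complex.arg z / (2 * Real.pi)

theorem circlePoint_circleAngle (z : Circle) : circlePoint (circleAngle z) = z := by
  have := Real.pi_pos
  rw [circlePoint, circleAngle, mul_div_cancel₀ _ (by positivity), Circle.exp_arg]

theorem circleAngle_circlePoint {t : ℝ} (h : |t| < 1 / 2) : circleAngle (circlePoint t) = t := by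
  have hp := Real.pi_pos
  rw [abs_lt] at h
  rw [circleAngle, circlePoint, Circle.arg_exp (by nlinarith) (by nlinarith)]
  field_simp

/-- Near `1` the angle is the imaginary part of the complex logarithm. Smoothness at this single
point suffices, since other points are brought to `1` by the group law. -/
theorem contMDiffAt_circleAngle : ContMDiffAt (𝓡 1) 𝓘(ℝ, ℝ) ∞ circleAngle 1 := by
  have h1 : ContMDiff (𝓡 1) 𝓘(ℝ, ℂ) ∞ (fun z : Circle => (z : ℂ)) :=
    haveI := finrank_real_complex_fact'
    contMDiff_coe_sphere
  have h2 : ContDiffAt ℝ ∞ (fun z : ℂ => (Complex.log z).im / (2 * Real.pi)) 1 := by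
    refine ContDiffAt.div_const ?_ _
    exact Complex.imCLM.contDiff.contDiffAt.comp (1 : ℂ)
      ((Complex.contDiffAt_log (by simp)).restrict_scalars ℝ)
  refine (ContMDiffAt.comp (1 : Circle) (g := fun z : ℂ => (Complex.log z).im / (2 * Real.pi))
    (by simpa using h2.contMDiffAt) h1.contMDiffAt).congr_of_eventuallyEq
    (Filter.Eventually.of_forall fun z => ?_)
  simp [circleAngle, Complex.log_im]

/-- The covering map `ℝ² → T²`. -/
noncomputable def torusPoint (z : ℝ × ℝ) : Circle × Circle := (circlePoint z.1, circlePoint z.2)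

theorem torusPoint_surjective : Function.Surjective torusPoint := fun p =>
  ⟨(circleAngle p.1, circleAngle p.2), by simp [torusPoint, circlePoint_circleAngle]⟩

theorem continuous_torusPoint : Continuous torusPoint := by
  have := continuous_circlePoint
  unfold torusPoint
  fun_prop

theorem contMDiff_torusPoint :
    ContMDiff 𝓘(ℝ, ℝ × ℝ) ((𝓡 1).prod (𝓡 1)) ∞ torusPoint :=
  (contMDiff_circlePoint.comp contDiff_fst.contMDiff).prodMk
    (contMDiff_circlePoint.comp contDiff_snd.contMDiff)

theorem kroneckerFlow_torusPoint (α t : ℝ) (z : ℝ × ℝ) :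
    (kroneckerFlow α).toFlow t (torusPoint z) = torusPoint (z.1 + α * t, z.2 + t) := by
  simp only [torusPoint, circlePoint_add]
  rfl

/-- A smooth local section of `torusPoint` through a given point of the plane. -/
noncomputable def torusSection (z : ℝ × ℝ) (p : Circle × Circle) : ℝ × ℝ :=
  (z.1 + circleAngle (p.1 * (circlePoint z.1)⁻¹), z.2 + circleAngle (p.2 * (circlePoint z.2)⁻¹))

theorem torusPoint_torusSection (z : ℝ × ℝ) (p : Circle × Circle) :
    torusPoint (torusSection z p) = p := by
  simp [torusPoint, torusSection, circlePoint_add, circlePoint_circleAngle]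

theorem contMDiffAt_torusSection (z : ℝ × ℝ) :
    ContMDiffAt ((𝓡 1).prod (𝓡 1)) 𝓘(ℝ, ℝ × ℝ) ∞ (torusSection z) (torusPoint z) := by
  have h : ∀ t : ℝ, ContMDiffAt (𝓡 1) 𝓘(ℝ, ℝ) ∞
      (fun w : Circle => t + circleAngle (w * (circlePoint t)⁻¹)) (circlePoint t) := by
    intro t
    refine contMDiffAt_const.add (ContMDiffAt.comp _ (g := circleAngle) ?_
      (contMDiffAt_id.mul contMDiffAt_const))
    simpa using contMDiffAt_circleAngle
  exact ContMDiffAt.prodMk_space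
    (ContMDiffAt.comp (torusPoint z)
      (g := fun w : Circle => z.1 + circleAngle (w * (circlePoint z.1)⁻¹)) (h z.1) contMDiffAt_fst)
    (ContMDiffAt.comp (torusPoint z)
      (g := fun w : Circle => z.2 + circleAngle (w * (circlePoint z.2)⁻¹)) (h z.2) contMDiffAt_snd)

section descend

variable {E' H' N : Type*} [NormedAddCommGroup E'] [NormedSpace ℝ E'] [TopologicalSpace H']
  {J : ModelWithCorners ℝ E' H'} [TopologicalSpace N] [ChartedSpace H' N]

/-- Smoothness of a map on the torus may be checked on the universal cover. -/
theorem contMDiff_of_comp_torusPoint {G : Circle × Circle → N}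
    (hG : ContMDiff 𝓘(ℝ, ℝ × ℝ) J ∞ (G ∘ torusPoint)) :
    ContMDiff ((𝓡 1).prod (𝓡 1)) J ∞ G := by
  intro p
  obtain ⟨z, rfl⟩ := torusPoint_surjective p
  have := ContMDiffAt.comp (torusPoint z) (hG (torusSection z (torusPoint z)))
    (contMDiffAt_torusSection z)
  refine this.congr_of_eventuallyEq (Filter.Eventually.of_forall fun q => ?_)
  simp [torusPoint_torusSection]

theorem contMDiff_of_comp_prod_torusPoint {G : ℝ × (Circle × Circle) → N}
    (hG : ContMDiff 𝓘(ℝ, ℝ × (ℝ × ℝ)) J ∞ (fun q : ℝ × (ℝ × ℝ) => G (q.1, torusPoint q.2))) :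
    ContMDiff (𝓘(ℝ, ℝ).prod ((𝓡 1).prod (𝓡 1))) J ∞ G := by
  rintro ⟨s, p⟩
  obtain ⟨z, rfl⟩ := torusPoint_surjective p
  have h1 : ContMDiffAt (𝓘(ℝ, ℝ).prod ((𝓡 1).prod (𝓡 1))) 𝓘(ℝ, ℝ × (ℝ × ℝ)) ∞
      (fun q : ℝ × (Circle × Circle) => (q.1, torusSection z q.2)) (s, torusPoint z) :=
    ContMDiffAt.prodMk_space contMDiffAt_fst
      (ContMDiffAt.comp (s, torusPoint z) (contMDiffAt_torusSection z) contMDiffAt_snd)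
  have := ContMDiffAt.comp (s, torusPoint z) (hG (s, torusSection z (torusPoint z))) h1
  refine this.congr_of_eventuallyEq (Filter.Eventually.of_forall fun q => ?_)
  simp [torusPoint_torusSection]

end descend

/-- A continuous real lift of a smooth circle-valued map is smooth. -/
theorem contDiff_of_contMDiff_circlePoint {E : Type*} [NormedAddCommGroup E] [NormedSpace ℝ E]
    {β : E → ℝ} (hc : Continuous β)
    (hs : ContMDiff 𝓘(ℝ, E) (𝓡 1) ∞ (fun z => circlePoint (β z))) : ContDiff ℝ ∞ β := by
  rw [← contMDiff_iff_contDiff]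
  intro z₀
  have h1 : ContMDiffAt 𝓘(ℝ, E) 𝓘(ℝ, ℝ) ∞
      (fun z => β z₀ + circleAngle (circlePoint (β z) * (circlePoint (β z₀))⁻¹)) z₀ := by
    refine contMDiffAt_const.add (ContMDiffAt.comp z₀ (g := circleAngle) ?_
      ((hs z₀).mul contMDiffAt_const))
    simpa using contMDiffAt_circleAngle
  refine h1.congr_of_eventuallyEq ?_
  have h2 : ∀ᶠ z in 𝓝 z₀, dist (β z) (β z₀) < 1 / 2 :=
    hc.continuousAt.eventually (Metric.ball_mem_nhds _ (by norm_num))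
  filter_upwards [h2] with z hz
  rw [← circlePoint_neg, ← circlePoint_add, ← sub_eq_add_neg,
    circleAngle_circlePoint (by rwa [Real.dist_eq] at hz)]
  ring

/-- A continuous circle-valued map on a simply connected space lifts through `circlePoint`. -/
theorem exists_continuous_circlePoint_lift {Z : Type*} [TopologicalSpace Z]
    [SimplyConnectedSpace Z] [LocallyPathConnectedSpace Z] {f : Z → Circle} (hf : Continuous f) :
    ∃ g : Z → ℝ, Continuous g ∧ ∀ z, circlePoint (g z) = f z := by
  have hp := Real.pi_pos
  obtain ⟨z₀⟩ : Nonempty Z := inferInstance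
  obtain ⟨F, ⟨-, hF⟩, -⟩ := Circle.isCoveringMap_exp.existsUnique_continuousMap_lifts ⟨f, hf⟩ z₀
    (Complex.arg (f z₀)) (Circle.exp_arg _)
  refine ⟨fun z => F z / (2 * Real.pi), by fun_prop, fun z => ?_⟩
  rw [circlePoint, mul_div_cancel₀ _ (by positivity)]
  exact congr_fun hF z

/-- A countable set of reals is totally disconnected. This serves for `ℤ + αℤ`, which is dense when
`α` is irrational, so that discreteness cannot be used. -/
theorem Continuous.eq_of_range_subset_countable {Z : Type*} [TopologicalSpace Z]
    [PreconnectedSpace Z] {g : Z → ℝ} (hg : Continuous g) {s : Set ℝ} (hs : s.Countable)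
    (hgs : ∀ z, g z ∈ s) (z w : Z) : g z = g w :=
  hs.isTotallyDisconnected (Set.range g) (Set.range_subset_iff.2 hgs)
    (isPreconnected_range hg) ⟨z, rfl⟩ ⟨w, rfl⟩

theorem kroneckerFlow_free {α : ℝ} (hα : Irrational α) {t : ℝ} {p : Circle × Circle}
    (h : (kroneckerFlow α).toFlow t p = p) : t = 0 := by
  obtain ⟨z, rfl⟩ := torusPoint_surjective p
  rw [kroneckerFlow_torusPoint, torusPoint, torusPoint, Prod.mk.injEq, circlePoint_eq_iff,
    circlePoint_eq_iff] at h
  obtain ⟨⟨m, hm⟩, n, hn⟩ := h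
  have hm' : α * t = m := by simpa using hm
  have hn' : t = n := by simpa using hn
  by_contra h0
  have hn0 : n ≠ 0 := by rintro rfl; simp [hn'] at h0
  refine (hα.mul_intCast hn0) ⟨m, ?_⟩
  rw [← hn', hm']; simp

/-- A continuous map sending every `z` into the leaf through `torusPoint (B z)` moves points along
the leaves by a continuous time. -/
theorem exists_continuous_leafwise_time {α : ℝ} {Z : Type*} [TopologicalSpace Z]
    [SimplyConnectedSpace Z] [LocallyPathConnectedSpace Z] {H : Z → Circle × Circle}
    (hH : Continuous H) {B : Z → ℝ × ℝ} (hB : Continuous B)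
    (hHB : ∀ z, ∃ t, H z = (kroneckerFlow α).toFlow t (torusPoint (B z))) :
    ∃ β : Z → ℝ, Continuous β ∧ ∀ z, H z = (kroneckerFlow α).toFlow (β z) (torusPoint (B z)) := by
  obtain ⟨X, hX, hXH⟩ := exists_continuous_circlePoint_lift (continuous_fst.comp hH)
  obtain ⟨Y, hY, hYH⟩ := exists_continuous_circlePoint_lift (continuous_snd.comp hH)
  -- The displacement of the lift transverse to the lines of slope `α` vanishes up to a deck
  -- transformation, hence lies in `ℤ + αℤ`; being continuous, it is constant.
  have key : ∀ z, ∃ m n : ℤ, X z - (B z).1 - α * (Y z - (B z).2) = m + α * n := by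
    intro z
    obtain ⟨t, ht⟩ := hHB z
    have h1 := hXH z
    have h2 := hYH z
    rw [kroneckerFlow_torusPoint] at ht
    simp only [Function.comp_apply, ht, torusPoint, circlePoint_eq_iff] at h1 h2
    obtain ⟨m, hm⟩ := h1
    obtain ⟨n, hn⟩ := h2
    refine ⟨m, -n, ?_⟩
    rw [hm, hn]
    push_cast
    ring
  obtain ⟨z₀⟩ : Nonempty Z := inferInstance
  obtain ⟨m, n, hmn⟩ := key z₀
  have hconst : ∀ z, X z - (B z).1 - α * (Y z - (B z).2) = m + α * n := by
    intro z
    rw [← hmn]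
    refine Continuous.eq_of_range_subset_countable
      (g := fun z => X z - (B z).1 - α * (Y z - (B z).2)) (by fun_prop)
      (s := Set.range fun q : ℤ × ℤ => (q.1 : ℝ) + α * q.2) (Set.countable_range _) ?_ _ _
    intro z
    obtain ⟨m, n, h⟩ := key z
    exact ⟨(m, n), h.symm⟩
  -- The extra time `n` absorbs the part `α * n` of the constant; the integers `m` and `-n` that
  -- remain are invisible on the torus.
  refine ⟨fun z => Y z - (B z).2 + n, by fun_prop, fun z => ?_⟩
  rw [kroneckerFlow_torusPoint]
  refine Prod.ext ?_ ?_
  · rw [← Function.comp_apply (f := Prod.fst), ← hXH, torusPoint]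
    refine circlePoint_eq_iff.2 ⟨m, ?_⟩
    simp only
    linear_combination hconst z
  · rw [← Function.comp_apply (f := Prod.snd), ← hYH, torusPoint]
    refine circlePoint_eq_iff.2 ⟨-n, ?_⟩
    simp only
    push_cast
    ring

/-! ### Fourier series and the cohomological equation over a rotation. -/

section fourier

open Complex

/-- The Fourier coefficient of a `1`-periodic function on the line. -/
noncomputable def periodicFourierCoeff (f : ℝ → ℂ) (k : ℤ) : ℂ :=
  ∫ x in (0 : ℝ)..1, fourier (-k) (x : UnitAddCircle) * f x

theorem fourier_unitAddCircle_apply (k : ℤ) (x : ℝ) :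
    fourier k (x : UnitAddCircle) = cexp (2 * Real.pi * I * k * x) := by
  simp

theorem fourier_unitAddCircle_add (k : ℤ) (x y : ℝ) :
    (fourier k ((x + y : ℝ) : UnitAddCircle) : ℂ) =
      fourier k (x : UnitAddCircle) * fourier k (y : UnitAddCircle) := by
  simp only [fourier_unitAddCircle_apply, ← Complex.exp_add]
  push_cast
  ring_nf

theorem norm_fourier_unitAddCircle (k : ℤ) (x : UnitAddCircle) : ‖(fourier k x : ℂ)‖ = 1 := by
  rw [fourier_apply, Circle.norm_coe]

theorem hasDerivAt_fourier_unitAddCircle (k : ℤ) (x : ℝ) :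
    HasDerivAt (fun y : ℝ => (fourier k (y : UnitAddCircle) : ℂ))
      (2 * Real.pi * I * k * fourier k (x : UnitAddCircle)) x := by
  simpa using hasDerivAt_fourier 1 k x

theorem continuous_fourier_unitAddCircle (k : ℤ) :
    Continuous (fun y : ℝ => (fourier k (y : UnitAddCircle) : ℂ)) :=
  (map_continuous (fourier k)).comp (AddCircle.continuous_mk' 1)

theorem iteratedDeriv_fourier_unitAddCircle (k : ℤ) (n : ℕ) :
    iteratedDeriv n (fun y : ℝ => (fourier k (y : UnitAddCircle) : ℂ)) =
      fun x : ℝ => (2 * Real.pi * I * k) ^ n * fourier k (x : UnitAddCircle) := by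
  induction n with
  | zero => simp
  | succ n ih =>
    rw [iteratedDeriv_succ, ih]
    ext x
    rw [((hasDerivAt_fourier_unitAddCircle k x).const_mul _).deriv]
    ring

theorem contDiff_fourier_unitAddCircle (k : ℤ) :
    ContDiff ℝ ∞ (fun y : ℝ => (fourier k (y : UnitAddCircle) : ℂ)) := by
  simp only [fourier_unitAddCircle_apply]
  exact (contDiff_const.mul Complex.ofRealCLM.contDiff).cexp

theorem norm_periodicFourierCoeff_le {f : ℝ → ℂ} {M : ℝ} (h : ∀ x ∈ Set.Icc (0 : ℝ) 1, ‖f x‖ ≤ M)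
    (k : ℤ) : ‖periodicFourierCoeff f k‖ ≤ M := by
  have := intervalIntegral.norm_integral_le_of_norm_le_const (a := (0 : ℝ)) (b := 1)
    (f := fun x : ℝ => (fourier (-k) (x : UnitAddCircle) : ℂ) * f x) (C := M) (by
      intro x hx
      rw [Set.uIoc_of_le zero_le_one] at hx
      rw [norm_mul, norm_fourier_unitAddCircle, one_mul]
      exact h x (Set.Ioc_subset_Icc_self hx))
  simpa [periodicFourierCoeff] using this

theorem periodicFourierCoeff_deriv {f f' : ℝ → ℂ} (hf : ∀ x, HasDerivAt f (f' x) x)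
    (hf' : Continuous f') (hp : Function.Periodic f 1) (k : ℤ) :
    periodicFourierCoeff f' k = 2 * Real.pi * I * k * periodicFourierCoeff f k := by
  have h := intervalIntegral.integral_mul_deriv_eq_deriv_mul (a := (0 : ℝ)) (b := 1)
    (fun x _ => hasDerivAt_fourier_unitAddCircle (-k) x) (fun x _ => hf x)
    ((continuous_const.mul (continuous_fourier_unitAddCircle _)).intervalIntegrable _ _)
    (hf'.intervalIntegrable _ _)
  have h1 : f 1 = f 0 := by simpa using hp 0
  have h2 : ((1 : ℝ) : UnitAddCircle) = ((0 : ℝ) : UnitAddCircle) := by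
    simp
  rw [periodicFourierCoeff, h, h1, h2, sub_self, zero_sub, periodicFourierCoeff,
    ← intervalIntegral.integral_neg, ← intervalIntegral.integral_const_mul]
  refine intervalIntegral.integral_congr fun x _ => ?_
  push_cast
  ring

theorem Function.Periodic.deriv_periodic {f : ℝ → ℂ} {c : ℝ} (hp : Function.Periodic f c) :
    Function.Periodic (deriv f) c := by
  intro x
  rw [← deriv_comp_add_const, funext hp]

/-- Fourier coefficients of smooth periodic functions decay rapidly. -/
theorem exists_pow_mul_norm_periodicFourierCoeff_le (n : ℕ) :
    ∀ {f : ℝ → ℂ}, ContDiff ℝ ∞ f → Function.Periodic f 1 →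
      ∃ M, ∀ k : ℤ, |(k : ℝ)| ^ n * ‖periodicFourierCoeff f k‖ ≤ M := by
  induction n with
  | zero =>
    intro f hf _
    obtain ⟨M, hM⟩ := isCompact_Icc.exists_bound_of_continuousOn (s := Set.Icc (0 : ℝ) 1)
      hf.continuous.continuousOn
    exact ⟨M, fun k => by simpa using norm_periodicFourierCoeff_le hM k⟩
  | succ n ih =>
    intro f hf hp
    have hd : ContDiff ℝ ∞ (deriv f) := (contDiff_infty_iff_deriv.1 hf).2
    obtain ⟨M, hM⟩ := ih hd hp.deriv_periodic
    refine ⟨M, fun k => le_trans ?_ (hM k)⟩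
    rw [periodicFourierCoeff_deriv (fun x => ((contDiff_infty_iff_deriv.1 hf).1 x).hasDerivAt)
      hd.continuous hp, pow_succ, mul_assoc]
    gcongr
    rw [norm_mul]
    gcongr
    have hpi := Real.pi_gt_three
    have : ‖(2 * Real.pi * I * k : ℂ)‖ = 2 * Real.pi * |(k : ℝ)| := by
      simp [abs_of_pos Real.pi_pos]
    rw [this]
    nlinarith [abs_nonneg (k : ℝ)]

theorem summable_pow_mul_norm_of_rapid_decay {c : ℤ → ℂ}
    (hc : ∀ n : ℕ, ∃ M, ∀ k : ℤ, |(k : ℝ)| ^ n * ‖c k‖ ≤ M) (n : ℕ) :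
    Summable fun k : ℤ => |(k : ℝ)| ^ n * ‖c k‖ := by
  obtain ⟨M, hM⟩ := hc (n + 2)
  have h1 : Summable fun k : ℤ => M * (1 / (k : ℝ) ^ 2) :=
    (Real.summable_one_div_int_pow.2 one_lt_two).mul_left M
  refine h1.of_norm_bounded_eventually ?_
  -- At `k = 0` the majorant is `0` by the convention for division, so the comparison is made off
  -- that point.
  have h0 : ∀ᶠ k : ℤ in Filter.cofinite, k ≠ 0 := (Set.finite_singleton (0 : ℤ)).compl_mem_cofinite
  filter_upwards [h0] with k hk
  have hk' : (0 : ℝ) < (k : ℝ) ^ 2 := by positivity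
  rw [mul_one_div, le_div_iff₀ hk', Real.norm_of_nonneg (by positivity)]
  calc _ = |(k : ℝ)| ^ (n + 2) * ‖c k‖ := by rw [pow_add, sq_abs]; ring
    _ ≤ M := hM k

theorem summable_fourier_of_rapid_decay {c : ℤ → ℂ}
    (hc : ∀ n : ℕ, ∃ M, ∀ k : ℤ, |(k : ℝ)| ^ n * ‖c k‖ ≤ M) (x : ℝ) :
    Summable fun k : ℤ => c k * fourier k (x : UnitAddCircle) := by
  refine Summable.of_norm ?_
  simp only [norm_mul, norm_fourier_unitAddCircle, mul_one]
  simpa using summable_pow_mul_norm_of_rapid_decay hc 0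

theorem contDiff_tsum_fourier_of_rapid_decay {c : ℤ → ℂ}
    (hc : ∀ n : ℕ, ∃ M, ∀ k : ℤ, |(k : ℝ)| ^ n * ‖c k‖ ≤ M) :
    ContDiff ℝ ∞ fun x : ℝ => ∑' k : ℤ, c k * fourier k (x : UnitAddCircle) := by
  refine contDiff_tsum (N := ⊤) (f := fun (k : ℤ) (x : ℝ) => c k * fourier k (x : UnitAddCircle))
    (v := fun n k => (2 * Real.pi) ^ n * (|(k : ℝ)| ^ n * ‖c k‖))
    (fun k => contDiff_const.mul (contDiff_fourier_unitAddCircle k)) (fun n _ =>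
      (summable_pow_mul_norm_of_rapid_decay hc n).mul_left _) ?_
  intro n k x _
  rw [norm_iteratedFDeriv_eq_norm_iteratedDeriv, iteratedDeriv_const_mul_field,
    iteratedDeriv_fourier_unitAddCircle]
  simp only [norm_mul, norm_pow, norm_fourier_unitAddCircle]
  simp [abs_of_pos Real.pi_pos]
  apply le_of_eq
  ring

theorem exists_continuousMap_unitAddCircle {f : ℝ → ℂ} (hf : Continuous f)
    (hp : Function.Periodic f 1) :
    ∃ g : C(UnitAddCircle, ℂ), (∀ x : ℝ, g (x : UnitAddCircle) = f x) ∧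
      ∀ k, fourierCoeff g k = periodicFourierCoeff f k := by
  refine ⟨⟨hp.lift, continuous_coinduced_dom.mpr hf⟩, fun x => rfl, fun k => ?_⟩
  rw [fourierCoeff_eq_intervalIntegral _ _ 0, periodicFourierCoeff]
  simp [Function.Periodic.lift_coe]

theorem hasSum_periodicFourierCoeff {f : ℝ → ℂ} (hf : ContDiff ℝ ∞ f)
    (hp : Function.Periodic f 1) (x : ℝ) :
    HasSum (fun k : ℤ => periodicFourierCoeff f k * fourier k (x : UnitAddCircle)) (f x) := by
  obtain ⟨g, hgf, hg⟩ := exists_continuousMap_unitAddCircle hf.continuous hp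
  have hs : Summable (fourierCoeff g) := by
    refine Summable.of_norm ?_
    simp only [hg]
    simpa using summable_pow_mul_norm_of_rapid_decay
      (fun n => exists_pow_mul_norm_periodicFourierCoeff_le n hf hp) 0
  have := has_pointwise_sum_fourier_series_of_summable hs (x : UnitAddCircle)
  simpa only [hg, smul_eq_mul, hgf] using this

/-- The Riemann–Lebesgue lemma, from the square-summability of the coefficients. Continuity is
enough, so obstructions to rigidity need no smoothness of the transfer function. -/
theorem tendsto_periodicFourierCoeff {f : ℝ → ℂ} (hf : Continuous f)
    (hp : Function.Periodic f 1) :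
    Filter.Tendsto (periodicFourierCoeff f) Filter.cofinite (𝓝 0) := by
  obtain ⟨g, -, hg⟩ := exists_continuousMap_unitAddCircle hf hp
  have h1 := (hasSum_sq_fourierCoeff
    (ContinuousMap.toLp (E := ℂ) 2 AddCircle.haarAddCircle ℂ g)).summable.tendsto_cofinite_zero
  simp only [fourierCoeff_toLp, hg] at h1
  rw [tendsto_zero_iff_norm_tendsto_zero]
  have h2 := h1.sqrt
  simpa using h2

theorem periodicFourierCoeff_comp_add {f : ℝ → ℂ} (hp : Function.Periodic f 1) (α : ℝ) (k : ℤ) :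
    periodicFourierCoeff (fun x => f (x + α)) k =
      fourier k (α : UnitAddCircle) * periodicFourierCoeff f k := by
  set h : ℝ → ℂ := fun x => fourier (-k) (x : UnitAddCircle) * f x with hh
  have hhp : Function.Periodic h 1 := fun x => by
    simp only [hh, hp x, AddCircle.coe_add_period]
  have h1 : ∀ x : ℝ, (fourier (-k) (x : UnitAddCircle) : ℂ) * f (x + α) =
      fourier k (α : UnitAddCircle) * h (x + α) := by
    intro x
    have h2 : (fourier k (α : UnitAddCircle) : ℂ) * fourier (-k) (α : UnitAddCircle) = 1 := by
      rw [← fourier_add, add_neg_cancel, fourier_zero]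
    simp only [hh, fourier_unitAddCircle_add]
    linear_combination (-(fourier (-k) (x : UnitAddCircle) : ℂ) * f (x + α)) * h2
  simp only [periodicFourierCoeff, h1]
  rw [intervalIntegral.integral_const_mul, intervalIntegral.integral_comp_add_right,
    zero_add, add_comm 1 α, hhp.intervalIntegral_add_eq α 0, zero_add]

theorem periodicFourierCoeff_fourier (m k : ℤ) :
    periodicFourierCoeff (fun x : ℝ => fourier m (x : UnitAddCircle)) k =
      if k = m then 1 else 0 := by
  have h1 := congr_fun (fourierCoeff_fourier (T := 1) m) k
  rw [fourierCoeff_eq_intervalIntegral _ _ 0, Pi.single_apply] at h1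
  rw [← h1, periodicFourierCoeff, zero_add, div_one, one_smul]
  rfl

theorem periodicFourierCoeff_cos {m k : ℕ} (hm : 1 ≤ m) (hk : 1 ≤ k) :
    periodicFourierCoeff (fun x : ℝ => (Real.cos (2 * Real.pi * (m * x)) : ℂ)) k =
      if k = m then 1 / 2 else 0 := by
  have h1 : ∀ x : ℝ, (Real.cos (2 * Real.pi * (m * x)) : ℂ) =
      2⁻¹ * fourier (m : ℤ) (x : UnitAddCircle) + 2⁻¹ * fourier (-(m : ℤ)) (x : UnitAddCircle) := by
    intro x
    rw [Complex.ofReal_cos, Complex.cos, fourier_unitAddCircle_apply, fourier_unitAddCircle_apply]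
    push_cast
    ring_nf
  have h2 := periodicFourierCoeff_fourier (m : ℤ) k
  have h3 := periodicFourierCoeff_fourier (-(m : ℤ)) k
  rw [if_neg (by omega)] at h3
  simp only [periodicFourierCoeff] at h2 h3 ⊢
  have hinteg : ∀ n : ℤ, IntervalIntegrable (fun x : ℝ =>
      (fourier (-(k : ℤ)) (x : UnitAddCircle) : ℂ) * (2⁻¹ * fourier n (x : UnitAddCircle))) MeasureTheory.volume 0 1 := fun n =>
    ((continuous_fourier_unitAddCircle _).mul
      (continuous_const.mul (continuous_fourier_unitAddCircle n))).intervalIntegrable _ _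
  simp only [h1, mul_add]
  rw [intervalIntegral.integral_add (hinteg _) (hinteg _)]
  simp only [mul_left_comm _ (2⁻¹ : ℂ), intervalIntegral.integral_const_mul, h2, h3]
  split_ifs <;> simp_all

/-- With `δ` the signed distance from `kα` to the nearest integer, the right side is `2 sin (π|δ|)`,
and Jordan's inequality on `[0, π/2]` bounds it below by `4|δ|`. This converts the arithmetic
condition into a bound on small divisors. -/
theorem norm_le_norm_fourier_sub_one (k : ℤ) (α : ℝ) :
    ‖((k * α : ℝ) : UnitAddCircle)‖ ≤ ‖(fourier k (α : UnitAddCircle) : ℂ) - 1‖ := by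
  have hp := Real.pi_gt_three
  set δ : ℝ := k * α - round (k * α : ℝ) with hδ
  have h1 : (fourier k (α : UnitAddCircle) : ℂ) = cexp (I * (2 * Real.pi * δ : ℝ)) := by
    rw [fourier_unitAddCircle_apply, Complex.exp_eq_exp_iff_exists_int]
    refine ⟨round (k * α : ℝ), ?_⟩
    rw [hδ]
    push_cast
    ring
  rw [h1, Complex.norm_exp_I_mul_ofReal_sub_one, UnitAddCircle.norm_eq, ← hδ, norm_mul,
    Real.norm_eq_abs, Real.norm_eq_abs, abs_two]
  have h2 : |δ| ≤ 1 / 2 := abs_sub_round _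
  have h3 : |Real.sin (2 * Real.pi * δ / 2)| = Real.sin (Real.pi * |δ|) := by
    rw [show 2 * Real.pi * δ / 2 = Real.pi * δ by ring, Real.abs_sin_eq_sin_abs_of_abs_le_pi,
      abs_mul, abs_of_pos Real.pi_pos]
    rw [abs_mul, abs_of_pos Real.pi_pos]
    nlinarith
  rw [h3]
  have h4 := Real.mul_le_sin (x := Real.pi * |δ|) (by positivity) (by nlinarith)
  have h5 : 2 / Real.pi * (Real.pi * |δ|) = 2 * |δ| := by field_simp
  linarith [abs_nonneg δ]

theorem fourier_sub_one_ne_zero {α : ℝ} (h : IsBadlyApproximable α) {k : ℤ} (hk : k ≠ 0) :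
    (fourier k (α : UnitAddCircle) : ℂ) - 1 ≠ 0 := by
  obtain ⟨C, hC, ρ, hρ, h⟩ := h
  have h1 := h k hk
  have h2 : 0 < C * |(k : ℝ)| ^ (-ρ) := by positivity
  have h3 := norm_le_norm_fourier_sub_one k α
  exact norm_pos_iff.1 (by linarith)

/-- The cohomological equation over a Diophantine rotation is solvable in smooth functions. -/
theorem exists_contDiff_cohomological {α : ℝ} (h : IsBadlyApproximable α) {w : ℝ → ℝ}
    (hw : ContDiff ℝ ∞ w) (hp : Function.Periodic w 1) :
    ∃ v : ℝ → ℝ, ContDiff ℝ ∞ v ∧ Function.Periodic v 1 ∧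
      ∀ x, v (x + α) - v x = w x - ∫ y in (0 : ℝ)..1, w y := by
  set f : ℝ → ℂ := fun x => (w x : ℂ) with hf_def
  have hf : ContDiff ℝ ∞ f := Complex.ofRealCLM.contDiff.comp hw
  have hfp : Function.Periodic f 1 := fun x => by simp only [hf_def, hp x]
  set a := periodicFourierCoeff f with ha
  -- Comparing coefficients forces this quotient for `k ≠ 0`; the coefficient at `0` is free because
  -- constants are coboundaries of zero.
  set c : ℤ → ℂ := fun k => if k = 0 then 0 else a k / (fourier k (α : UnitAddCircle) - 1) with hc
  have hdecay : ∀ n : ℕ, ∃ M, ∀ k : ℤ, |(k : ℝ)| ^ n * ‖c k‖ ≤ M := by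
    intro n
    obtain ⟨C, hC, ρ, hρ, hba⟩ := id h
    -- The small divisor costs at most a factor `|k| ^ ρ / C`, so `⌈ρ⌉₊` additional powers of decay
    -- pay for it.
    obtain ⟨M, hM⟩ := exists_pow_mul_norm_periodicFourierCoeff_le (n + ⌈ρ⌉₊) hf hfp
    refine ⟨M / C, fun k => ?_⟩
    by_cases hk : k = 0
    · have : 0 ≤ M := le_trans (by positivity) (hM 0)
      simp only [hc, hk, if_true, norm_zero, mul_zero]
      positivity
    · have hk1 : (1 : ℝ) ≤ |(k : ℝ)| := by
        exact_mod_cast Int.one_le_abs hk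
      have hk0 : (0 : ℝ) < |(k : ℝ)| := by linarith
      have h1 : C * |(k : ℝ)| ^ (-ρ) ≤ ‖(fourier k (α : UnitAddCircle) : ℂ) - 1‖ :=
        (hba k hk).le.trans (norm_le_norm_fourier_sub_one k α)
      have h2 : |(k : ℝ)| ^ ρ ≤ |(k : ℝ)| ^ ⌈ρ⌉₊ := by
        rw [← Real.rpow_natCast]
        exact Real.rpow_le_rpow_of_exponent_le hk1 (Nat.le_ceil ρ)
      simp only [hc, hk, if_false, norm_div]
      calc |(k : ℝ)| ^ n * (‖a k‖ / ‖(fourier k (α : UnitAddCircle) : ℂ) - 1‖)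
          ≤ |(k : ℝ)| ^ n * (‖a k‖ / (C * |(k : ℝ)| ^ (-ρ))) := by gcongr
        _ = |(k : ℝ)| ^ n * |(k : ℝ)| ^ ρ * ‖a k‖ / C := by
          rw [Real.rpow_neg hk0.le]
          field_simp
        _ ≤ |(k : ℝ)| ^ n * |(k : ℝ)| ^ ⌈ρ⌉₊ * ‖a k‖ / C := by gcongr
        _ ≤ M / C := by
          rw [← pow_add]
          gcongr
          exact hM k
  set V : ℝ → ℂ := fun x => ∑' k : ℤ, c k * fourier k (x : UnitAddCircle) with hV
  have ha0 : a 0 = ((∫ y in (0 : ℝ)..1, w y : ℝ) : ℂ) := by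
    simp [ha, periodicFourierCoeff, hf_def, intervalIntegral.integral_ofReal]
  have key : ∀ x, V (x + α) - V x = f x - a 0 := by
    intro x
    have h1 := (summable_fourier_of_rapid_decay hdecay (x + α)).hasSum.sub
      (summable_fourier_of_rapid_decay hdecay x).hasSum
    have h2 := (hasSum_periodicFourierCoeff hf hfp x).sub
      (hasSum_ite_eq (0 : ℤ) (a 0))
    refine h1.unique ?_
    convert h2 using 2 with k
    by_cases hk : k = 0
    · simp [hc, hk, ha]
    · have := fourier_sub_one_ne_zero h hk
      simp only [hc, hk, if_false, fourier_unitAddCircle_add, sub_zero]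
      field_simp
      rw [ha]
  -- The data are real, so the real part of the complex solution is again a solution.
  refine ⟨fun x => (V x).re, Complex.reCLM.contDiff.comp
    (contDiff_tsum_fourier_of_rapid_decay hdecay), fun x => ?_, fun x => ?_⟩
  · simp only [hV, AddCircle.coe_add_period]
  · have := congr_arg Complex.re (key x)
    rw [ha0, Complex.sub_re, Complex.sub_re, Complex.ofReal_re] at this
    simpa [hf_def] using this

end fourier

/-! ### Smooth dependence of inverses and integrals on parameters. -/

/-- The fibrewise inverse of a smooth family of bijections of the line with nonvanishing derivative
is smooth. -/
theorem contDiff_fiberwise_inverse {E : Type*} [NormedAddCommGroup E] [NormedSpace ℝ E]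
    [CompleteSpace E] {h k : E × ℝ → ℝ} (hh : ContDiff ℝ ∞ h)
    (hd : ∀ z s, deriv (fun s => h (z, s)) s ≠ 0)
    (hinj : ∀ z, Function.Injective fun s => h (z, s)) (hk : ∀ z t, h (z, k (z, t)) = t) :
    ContDiff ℝ ∞ k := by
  rw [contDiff_iff_contDiffAt]
  rintro ⟨z, t⟩
  set q : E × ℝ := (z, k (z, t)) with hq
  set Φ : E × ℝ → E × ℝ := fun q => (q.1, h q) with hΦ
  have hΦs : ContDiffAt ℝ ∞ Φ q := (contDiff_fst.prodMk hh).contDiffAt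
  have hhd : HasFDerivAt h (fderiv ℝ h q) q := (hh.differentiable (by simp) q).hasFDerivAt
  set L := fderiv ℝ h q with hL
  have hL1 : L (0, 1) ≠ 0 := by
    have h1 : HasDerivAt (fun s : ℝ => ((z, s) : E × ℝ)) (0, 1) (k (z, t)) :=
      (hasDerivAt_const _ _).prodMk (hasDerivAt_id _)
    have h2 := (HasFDerivAt.comp_hasDerivAt (k (z, t)) (f := fun s : ℝ => ((z, s) : E × ℝ))
      hhd h1).deriv
    have h3 := hd z (k (z, t))
    intro h0
    rw [h0] at h2
    exact h3 h2
  have hLsplit : ∀ v r, L (v, r) = L (v, 0) + r * L (0, 1) := by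
    intro v r
    rw [← smul_eq_mul, ← map_smul, ← map_add]
    simp
  -- The derivative of `Φ` is triangular with nonzero corner `L (0, 1)`, so its inverse is explicit.
  let e : (E × ℝ) ≃L[ℝ] (E × ℝ) := ContinuousLinearEquiv.equivOfInverse
    ((ContinuousLinearMap.fst ℝ E ℝ).prod L)
    ((ContinuousLinearMap.fst ℝ E ℝ).prod
      ((L (0, 1))⁻¹ • (ContinuousLinearMap.snd ℝ E ℝ -
        L.comp ((ContinuousLinearMap.inl ℝ E ℝ).comp (ContinuousLinearMap.fst ℝ E ℝ)))))
    (by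
      rintro ⟨v, r⟩
      simp only [ContinuousLinearMap.prod_apply, Prod.mk.injEq]
      refine ⟨rfl, ?_⟩
      simp [hLsplit v r]
      field_simp)
    (by
      rintro ⟨v, r⟩
      simp only [ContinuousLinearMap.prod_apply, Prod.mk.injEq]
      refine ⟨rfl, ?_⟩
      rw [hLsplit]
      simp
      field_simp
      ring)
  have hΦd : HasFDerivAt Φ (e : (E × ℝ) →L[ℝ] (E × ℝ)) q := hasFDerivAt_fst.prodMk hhd
  have hΦq : Φ q = (z, t) := by simp [hΦ, hq, hk]
  have hloc := hΦs.to_localInverse hΦd (by simp)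
  have hev := (hΦs.hasStrictFDerivAt' hΦd (by simp)).eventually_right_inverse
  rw [hΦq] at hloc hev
  refine (contDiff_snd.contDiffAt.comp (z, t) hloc).congr_of_eventuallyEq ?_
  -- Injectivity on whole fibres identifies the local inverse with `k`, whose continuity is not
  -- known beforehand.
  filter_upwards [hev] with p hp
  set r := (hΦs.hasStrictFDerivAt' hΦd (by simp)).localInverse Φ e q p with hr
  have h1 : r.1 = p.1 := (congr_arg Prod.fst hp : (Φ r).1 = p.1)
  have h2 : h r = p.2 := (congr_arg Prod.snd hp : (Φ r).2 = p.2)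
  apply hinj p.1
  change h (p.1, k (p.1, p.2)) = h (p.1, r.2)
  rw [hk, ← h1, ← h2]

/-- Integrals of smooth functions over a compact interval depend smoothly on parameters. -/
theorem contDiff_parametric_intervalIntegral_nat {E : Type} [NormedAddCommGroup E]
    [NormedSpace ℝ E] [ProperSpace E] (n : ℕ) :
    -- The target is quantified inside the induction because the derivative takes values in `E →L[ℝ]
    -- F`.
    ∀ {F : Type} [NormedAddCommGroup F] [NormedSpace ℝ F] {B : E × ℝ → F}
      (_ : ContDiff ℝ ∞ B), ContDiff ℝ n fun z => ∫ r in (0 : ℝ)..1, B (z, r) := by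
  induction n with
  | zero =>
    intro F _ _ B hB
    rw [Nat.cast_zero, contDiff_zero]
    have := hB.continuous
    exact intervalIntegral.continuous_parametric_intervalIntegral_of_continuous'
      (f := fun z r => B (z, r)) (by simpa [Function.uncurry_def] using this) 0 1
  | succ n ih =>
    intro F _ _ B hB
    set B' : E × ℝ → (E →L[ℝ] F) := fun q =>
      (fderiv ℝ B q).comp (ContinuousLinearMap.inl ℝ E ℝ) with hB'
    have hB's : ContDiff ℝ ∞ B' :=
      (hB.fderiv_right (m := ∞) (by simp)).clm_comp contDiff_const
    have hder : ∀ z, HasFDerivAt (fun z => ∫ r in (0 : ℝ)..1, B (z, r))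
        (∫ r in (0 : ℝ)..1, B' (z, r)) z := by
      intro z₀
      obtain ⟨M, hM⟩ := ((isCompact_closedBall z₀ 1).prod (isCompact_Icc (a := (0 : ℝ)) (b := 1)))
        |>.exists_bound_of_continuousOn hB's.continuous.continuousOn
      have hcB := hB.continuous
      have hcB' := hB's.continuous
      refine intervalIntegral.hasFDerivAt_integral_of_dominated_of_fderiv_le (bound := fun _ => M)
        (F := fun z r => B (z, r)) (F' := fun z r => B' (z, r))
        (Metric.closedBall_mem_nhds z₀ one_pos)
        (Filter.Eventually.of_forall fun z => Continuous.aestronglyMeasurable (by fun_prop))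
        (Continuous.intervalIntegrable (by fun_prop) _ _)
        (Continuous.aestronglyMeasurable (by fun_prop)) ?_
        intervalIntegrable_const ?_
      · refine Filter.Eventually.of_forall fun t ht z hz => hM (z, t) ⟨hz, ?_⟩
        rw [Set.uIoc_of_le zero_le_one] at ht
        exact Set.Ioc_subset_Icc_self ht
      · refine Filter.Eventually.of_forall fun t _ z _ => ?_
        have h1 : HasFDerivAt (fun z : E => ((z, t) : E × ℝ)) (ContinuousLinearMap.inl ℝ E ℝ) z :=
          hasFDerivAt_prodMk_left z t
        exact HasFDerivAt.comp z (g := B) (hB.differentiable (by simp) (z, t)).hasFDerivAt h1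
    rw [Nat.cast_succ]
    refine contDiff_succ_iff_fderiv.2 ⟨fun z => (hder z).differentiableAt, by simp, ?_⟩
    rw [show fderiv ℝ (fun z => ∫ r in (0 : ℝ)..1, B (z, r)) =
      fun z => ∫ r in (0 : ℝ)..1, B' (z, r) from funext fun z => (hder z).fderiv]
    exact ih hB's

/-- The primitive in the last variable of a smooth function is smooth. -/
theorem contDiff_primitive {E : Type} [NormedAddCommGroup E] [NormedSpace ℝ E] [ProperSpace E]
    {b : E × ℝ → ℝ} (hb : ContDiff ℝ ∞ b) :
    ContDiff ℝ ∞ fun q : E × ℝ => ∫ r in (0 : ℝ)..q.2, b (q.1, r) := by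
  -- Rescaling to `[0, 1]` moves the variable endpoint into the integrand.
  have h1 : (fun q : E × ℝ => ∫ r in (0 : ℝ)..q.2, b (q.1, r)) =
      fun q : E × ℝ => q.2 * ∫ r in (0 : ℝ)..1, b (q.1, r * q.2) := by
    ext q
    have := intervalIntegral.mul_integral_comp_mul_right (a := 0) (b := 1)
      (f := fun r => b (q.1, r)) q.2
    simpa using this.symm
  rw [h1]
  refine contDiff_snd.mul (contDiff_infty.2 fun n => ?_)
  exact contDiff_parametric_intervalIntegral_nat n
    (B := fun p : (E × ℝ) × ℝ => b (p.1.1, p.2 * p.1.2)) (by fun_prop)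

/-! ### Flows with the same orbits and their time changes. -/

theorem Flow.eq_of_apply_eq {M : Type*} [TopologicalSpace M] (ψ : Flow ℝ M) {p : M}
    (hfree : ∀ s, ψ s p = p → s = 0) {s t : ℝ} (h : ψ s p = ψ t p) : s = t := by
  have : ψ (-t + s) p = p := by
    rw [ψ.map_add, h, ← ψ.map_add, neg_add_cancel, ψ.map_zero_apply]
  linarith [hfree _ this]

/-- Translation by time `t` along the line of slope `α` through `z`. -/
def leafShift (α : ℝ) (z : ℝ × ℝ) (t : ℝ) : ℝ × ℝ := (z.1 + α * t, z.2 + t)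

theorem kroneckerFlow_torusPoint_eq (α t : ℝ) (z : ℝ × ℝ) :
    (kroneckerFlow α).toFlow t (torusPoint z) = torusPoint (leafShift α z t) :=
  kroneckerFlow_torusPoint α t z

theorem kroneckerFlow_time_unique {α : ℝ} (hα : Irrational α) {s t : ℝ} {p : Circle × Circle}
    (h : (kroneckerFlow α).toFlow s p = (kroneckerFlow α).toFlow t p) : s = t :=
  (kroneckerFlow α).toFlow.eq_of_apply_eq (fun _ => kroneckerFlow_free hα) h

theorem IsBadlyApproximable.irrational {α : ℝ} (h : IsBadlyApproximable α) : Irrational α := by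
  rintro ⟨q, rfl⟩
  obtain ⟨C, hC, ρ, -, h⟩ := h
  have hq : (q.den : ℤ) ≠ 0 := by exact_mod_cast q.den_ne_zero
  have h1 := h q.den hq
  have h2 : (((q.den : ℤ) : ℝ) * (q : ℝ) : ℝ) = (q.num : ℝ) := by
    have := Rat.den_mul_eq_num q
    exact_mod_cast this
  rw [h2, UnitAddCircle.norm_eq] at h1
  simp only [round_intCast, sub_self, abs_zero] at h1
  have h3 : 0 < C * |((q.den : ℤ) : ℝ)| ^ (-ρ) := by positivity
  linarith

/-- Time changes of the Kronecker flow are given by a smooth function on the universal cover. -/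
theorem exists_contDiff_timeChange {α : ℝ}
    (ψ : SmoothLocallyFreeFlow ((𝓡 1).prod (𝓡 1)) (Circle × Circle))
    (horb : ∀ x, ψ.toFlow.orbit x = (kroneckerFlow α).toFlow.orbit x) :
    ∃ τ : (ℝ × ℝ) × ℝ → ℝ, ContDiff ℝ ∞ τ ∧ ∀ z s,
      ψ.toFlow s (torusPoint z) = (kroneckerFlow α).toFlow (τ (z, s)) (torusPoint z) := by
  have hsm : ContMDiff 𝓘(ℝ, (ℝ × ℝ) × ℝ) ((𝓡 1).prod (𝓡 1)) ∞
      (fun q : (ℝ × ℝ) × ℝ => ψ.toFlow q.2 (torusPoint q.1)) :=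
    ContMDiff.comp (g := fun p : ℝ × (Circle × Circle) => ψ.toFlow p.1 p.2) ψ.contMDiff'
      (contDiff_snd.contMDiff.prodMk (contMDiff_torusPoint.comp contDiff_fst.contMDiff))
  obtain ⟨τ, hτ, h⟩ := exists_continuous_leafwise_time (α := α) hsm.continuous
    (B := fun q : (ℝ × ℝ) × ℝ => q.1) continuous_fst (by
      intro q
      have := ψ.toFlow.mem_orbit (torusPoint q.1) q.2
      rw [horb] at this
      obtain ⟨t, ht⟩ := this
      exact ⟨t, ht.symm⟩)
  refine ⟨τ, contDiff_of_contMDiff_circlePoint hτ ?_, fun z s => h (z, s)⟩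
  -- Dividing the second coordinate of the orbit by that of its starting point leaves `circlePoint`
  -- of `τ`; `τ` is thus a continuous lift of a smooth map.
  have h1 : ContMDiff 𝓘(ℝ, (ℝ × ℝ) × ℝ) (𝓡 1) ∞ (fun q : (ℝ × ℝ) × ℝ =>
      (ψ.toFlow q.2 (torusPoint q.1)).2 * circlePoint (-q.1.2)) :=
    (contMDiff_snd.comp hsm).mul (contMDiff_circlePoint.comp
      (contDiff_snd.comp contDiff_fst).neg.contMDiff)
  refine h1.congr fun q => ?_
  rw [h q, kroneckerFlow_torusPoint, torusPoint, ← circlePoint_add]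
  congr 1
  ring

section timeChange

variable {α : ℝ} {ψ : SmoothLocallyFreeFlow ((𝓡 1).prod (𝓡 1)) (Circle × Circle)}
  {τ : (ℝ × ℝ) × ℝ → ℝ}

theorem timeChange_zero (hα : Irrational α)
    (h : ∀ z s, ψ.toFlow s (torusPoint z) = (kroneckerFlow α).toFlow (τ (z, s)) (torusPoint z))
    (z : ℝ × ℝ) : τ (z, 0) = 0 :=
  kroneckerFlow_free hα (by rw [← h, ψ.toFlow.map_zero_apply])

theorem timeChange_add (hα : Irrational α)
    (h : ∀ z s, ψ.toFlow s (torusPoint z) = (kroneckerFlow α).toFlow (τ (z, s)) (torusPoint z))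
    (z : ℝ × ℝ) (s t : ℝ) : τ (z, s + t) = τ (z, s) + τ (leafShift α z (τ (z, s)), t) := by
  refine kroneckerFlow_time_unique hα (p := torusPoint z) ?_
  rw [← h, add_comm s t, ψ.toFlow.map_add, h z s, kroneckerFlow_torusPoint_eq, h,
    add_comm, (kroneckerFlow α).toFlow.map_add, kroneckerFlow_torusPoint_eq α (τ (z, s))]

/-- If the derivative vanished, the cocycle identity would carry this to time `0` at the point `z₁`
reached. Differentiating `τ (z₁, r + t) = τ (z₁, r) + τ (leafShift α z₁ (τ (z₁, r)), t)` at `r = 0`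
then kills the derivative at every `t`. So `z₁` would be fixed by `ψ`, against local freeness. -/
theorem deriv_timeChange_ne_zero (hα : Irrational α) (hτ : ContDiff ℝ ∞ τ)
    (h : ∀ z s, ψ.toFlow s (torusPoint z) = (kroneckerFlow α).toFlow (τ (z, s)) (torusPoint z))
    (z : ℝ × ℝ) (s : ℝ) : deriv (fun s => τ (z, s)) s ≠ 0 := by
  intro h0
  have hd : ∀ z, Differentiable ℝ fun s => τ (z, s) := fun z =>
    (hτ.comp (contDiff_const.prodMk contDiff_id)).differentiable (by simp)
  set z₁ := leafShift α z (τ (z, s)) with hz₁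
  have h1 : HasDerivAt (fun t => τ (z₁, t)) 0 0 := by
    have h2 : (fun t => τ (z₁, t)) = fun t => τ (z, s + t) - τ (z, s) := by
      ext t
      rw [timeChange_add hα h z s t]
      ring
    rw [h2]
    have h3 : HasDerivAt (fun s => τ (z, s)) 0 (s + 0) := by
      rw [add_zero, ← h0]
      exact (hd z s).hasDerivAt
    exact (h3.comp_const_add s 0).sub_const _
  have h4 : ∀ t, deriv (fun t => τ (z₁, t)) t = 0 := by
    intro t
    have h5 : (fun r => τ (z₁, r + t)) =
        fun r => τ (z₁, r) + τ (leafShift α z₁ (τ (z₁, r)), t) :=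
      funext fun r => timeChange_add hα h z₁ r t
    have h6 : HasDerivAt (fun r => (leafShift α z₁ (τ (z₁, r)), t)) ((0, 0), 0) (0 : ℝ) := by
      have h61 := (h1.const_mul α).const_add z₁.1
      have h62 := h1.const_add z₁.2
      rw [mul_zero] at h61
      exact (h61.prodMk h62).prodMk (hasDerivAt_const _ _)
    have h7 : HasDerivAt (fun r => τ (leafShift α z₁ (τ (z₁, r)), t)) 0 (0 : ℝ) := by
      have := HasFDerivAt.comp_hasDerivAt (0 : ℝ) (l := τ)
        (hτ.differentiable (by simp) _).hasFDerivAt h6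
      have h0 : (((0, 0), 0) : (ℝ × ℝ) × ℝ) = 0 := rfl
      rw [h0, ContinuousLinearMap.map_zero] at this
      exact this
    have h8 : HasDerivAt (fun r => τ (z₁, r + t)) 0 0 := by
      rw [h5]
      have := h1.add h7
      rw [add_zero] at this
      exact this
    have h9 : HasDerivAt (fun r => τ (z₁, r + t)) (deriv (fun t => τ (z₁, t)) t) 0 := by
      have : HasDerivAt (fun r => τ (z₁, r)) (deriv (fun t => τ (z₁, t)) t) (0 + t) := by
        rw [zero_add]
        exact (hd z₁ t).hasDerivAt
      exact this.comp_add_const 0 t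
    exact h9.unique h8
  have h5 : ∀ t, ψ.toFlow t (torusPoint z₁) = torusPoint z₁ := by
    intro t
    have := is_const_of_deriv_eq_zero (hd z₁) h4 t 0
    simp only [timeChange_zero hα h] at this
    rw [h, this, (kroneckerFlow α).toFlow.map_zero_apply]
  obtain ⟨t, ht⟩ := (ψ.locallyFree' (torusPoint z₁)).exists
  exact ht (h5 t)

theorem timeChange_injective (hα : Irrational α) (hτ : ContDiff ℝ ∞ τ)
    (h : ∀ z s, ψ.toFlow s (torusPoint z) = (kroneckerFlow α).toFlow (τ (z, s)) (torusPoint z))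
    (z : ℝ × ℝ) : Function.Injective fun s => τ (z, s) := by
  have hc : Continuous fun s => τ (z, s) := hτ.continuous.comp (by fun_prop)
  have key : ∀ s t, s < t → τ (z, s) ≠ τ (z, t) := by
    intro s t hst heq
    obtain ⟨c, -, hc'⟩ := exists_deriv_eq_zero hst hc.continuousOn heq
    exact deriv_timeChange_ne_zero hα hτ h z c hc'
  intro s t hst
  rcases lt_trichotomy s t with hlt | heq | hgt
  · exact absurd hst (key s t hlt)
  · exact heq
  · exact absurd hst.symm (key t s hgt)

end timeChange

/-- If `ψ` has the orbits of an irrational Kronecker flow, then `ψ` is free and the `ψ`-time needed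
to follow the Kronecker flow is a smooth function on the universal cover. -/
theorem exists_contDiff_transitionTime {α : ℝ} (hα : Irrational α)
    (ψ : SmoothLocallyFreeFlow ((𝓡 1).prod (𝓡 1)) (Circle × Circle))
    (horb : ∀ x, ψ.toFlow.orbit x = (kroneckerFlow α).toFlow.orbit x) :
    (∀ p s, ψ.toFlow s p = p → s = 0) ∧
    ∃ σ : (ℝ × ℝ) × ℝ → ℝ, ContDiff ℝ ∞ σ ∧ ∀ z t,
      (kroneckerFlow α).toFlow t (torusPoint z) = ψ.toFlow (σ (z, t)) (torusPoint z) := by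
  obtain ⟨τ, hτ, h⟩ := exists_contDiff_timeChange ψ horb
  -- Equality of orbits supplies surjectivity of `s ↦ τ (z, s)`; the desired `σ` is the fibrewise
  -- inverse of `τ`.
  have hex : ∀ z t, ∃ s, τ (z, s) = t := by
    intro z t
    have := (kroneckerFlow α).toFlow.mem_orbit (torusPoint z) t
    rw [← horb] at this
    obtain ⟨s, hs⟩ := this
    exact ⟨s, kroneckerFlow_time_unique hα ((h z s).symm.trans hs)⟩
  choose σ hσ using hex
  refine ⟨fun p s hs => ?_, fun q => σ q.1 q.2, ?_, fun z t => ?_⟩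
  · obtain ⟨z, rfl⟩ := torusPoint_surjective p
    rw [h] at hs
    refine timeChange_injective hα hτ h z ?_
    simp only [timeChange_zero hα h, kroneckerFlow_free hα hs]
  · exact contDiff_fiberwise_inverse hτ (deriv_timeChange_ne_zero hα hτ h)
      (timeChange_injective hα hτ h) hσ
  · rw [h, hσ]

/-! ### Badly approximable slopes: the conjugacy. -/

section transition

variable {α : ℝ} {ψ : SmoothLocallyFreeFlow ((𝓡 1).prod (𝓡 1)) (Circle × Circle)}
  {σ : (ℝ × ℝ) × ℝ → ℝ}

theorem transitionTime_congr (hfree : ∀ p s, ψ.toFlow s p = p → s = 0)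
    (h : ∀ z t, (kroneckerFlow α).toFlow t (torusPoint z) = ψ.toFlow (σ (z, t)) (torusPoint z))
    {z z' : ℝ × ℝ} (hz : torusPoint z = torusPoint z') (t : ℝ) : σ (z, t) = σ (z', t) := by
  refine ψ.toFlow.eq_of_apply_eq (hfree (torusPoint z)) ?_
  rw [← h, hz, ← h]

theorem transitionTime_add (hfree : ∀ p s, ψ.toFlow s p = p → s = 0)
    (h : ∀ z t, (kroneckerFlow α).toFlow t (torusPoint z) = ψ.toFlow (σ (z, t)) (torusPoint z))
    (z : ℝ × ℝ) (s t : ℝ) : σ (z, s + t) = σ (z, s) + σ (leafShift α z s, t) := by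
  refine ψ.toFlow.eq_of_apply_eq (hfree (torusPoint z)) ?_
  rw [← h, add_comm s t, (kroneckerFlow α).toFlow.map_add, kroneckerFlow_torusPoint_eq, h,
    ← kroneckerFlow_torusPoint_eq, h z s, add_comm, ψ.toFlow.map_add]

/-- The cohomological equation is solved for the return time on `y = 0`, and the solution is
propagated along leaves by the cocycle `σ`. The constant `c` is the mean return time. -/
theorem exists_transfer_function (hba : IsBadlyApproximable α)
    (hfree : ∀ p s, ψ.toFlow s p = p → s = 0) (hσ : ContDiff ℝ ∞ σ)
    (h : ∀ z t, (kroneckerFlow α).toFlow t (torusPoint z) = ψ.toFlow (σ (z, t)) (torusPoint z)) :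
    ∃ c : ℝ, c ≠ 0 ∧ ∃ u : Circle × Circle → ℝ,
      ContMDiff ((𝓡 1).prod (𝓡 1)) 𝓘(ℝ, ℝ) ∞ u ∧
      ∀ z t, u ((kroneckerFlow α).toFlow t (torusPoint z)) - u (torusPoint z) =
        σ (z, t) - c * t := by
  set w : ℝ → ℝ := fun x => σ ((x, 0), 1) with hw_def
  have hw : ContDiff ℝ ∞ w := hσ.comp (by fun_prop)
  have hwp : Function.Periodic w 1 := fun x => transitionTime_congr hfree h (by
    simp only [torusPoint, Prod.mk.injEq, and_true, circlePoint_eq_iff]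
    exact ⟨1, by simp⟩) 1
  obtain ⟨v, hv, hvp, hvw⟩ := exists_contDiff_cohomological hba hw hwp
  set c := ∫ y in (0 : ℝ)..1, w y with hc
  have hw0 : ∀ x, w x ≠ 0 := by
    intro x hx
    have h1 := h (x, 0) 1
    change σ ((x, 0), 1) = 0 at hx
    rw [hx, ψ.toFlow.map_zero_apply] at h1
    exact one_ne_zero (kroneckerFlow_free hba.irrational h1)
  -- By the mean value theorem for integrals, `c` is itself a value of `w`, and `w` has no zeros.
  have hc0 : c ≠ 0 := by
    obtain ⟨x, -, hx⟩ := exists_eq_const_mul_intervalIntegral_of_nonneg (a := (0 : ℝ)) (b := 1)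
      (f := w) (g := fun _ => 1) (μ := MeasureTheory.volume)
      hw.continuous.continuousOn intervalIntegrable_const
      (fun _ _ => zero_le_one)
    have : c = w x := by simpa [hc] using hx
    rw [this]
    exact hw0 x
  -- The point `z` is reached from `(z.1 - α * z.2, 0)` in Kronecker time `z.2`. The identity for
  -- shifts along leaves is then automatic, and only periodicity in `y` uses the equation for `v`.
  set U : ℝ × ℝ → ℝ := fun z =>
    v (z.1 - α * z.2) + σ ((z.1 - α * z.2, 0), z.2) - c * z.2 with hU
  have hUs : ContDiff ℝ ∞ U := by
    have h1 : ContDiff ℝ ∞ fun z : ℝ × ℝ => v (z.1 - α * z.2) := hv.comp (by fun_prop)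
    have h2 : ContDiff ℝ ∞ fun z : ℝ × ℝ => σ ((z.1 - α * z.2, 0), z.2) :=
      hσ.comp (by fun_prop)
    exact (h1.add h2).sub (by fun_prop)
  have hUshift : ∀ z t, U (leafShift α z t) - U z = σ (z, t) - c * t := by
    intro z t
    have h1 := transitionTime_add hfree h (z.1 - α * z.2, 0) z.2 t
    have h2 : leafShift α (z.1 - α * z.2, 0) z.2 = z := by
      simp [leafShift]
    have h3 : z.1 + α * t - α * (z.2 + t) = z.1 - α * z.2 := by ring
    rw [h2] at h1
    simp only [hU, leafShift, h3, h1]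
    ring
  have hU1 : ∀ x y : ℝ, ∀ n : ℤ, U (x + n, y) = U (x, y) := by
    intro x y n
    have h1 : x + n - α * y = x - α * y + n := by ring
    have h2 : v (x - α * y + n) = v (x - α * y) := by simpa using hvp.int_mul n (x - α * y)
    have h3 : σ ((x - α * y + n, 0), y) = σ ((x - α * y, 0), y) :=
      transitionTime_congr hfree h (by
        simp only [torusPoint, Prod.mk.injEq, and_true, circlePoint_eq_iff]
        exact ⟨n, rfl⟩) y
    simp only [hU, h1, h2, h3]
  have hU2' : ∀ x : ℝ, Function.Periodic (fun y => U (x, y)) 1 := by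
    intro x y
    have h1 := transitionTime_add hfree h (x - α * (y + 1), 0) 1 y
    have h2 : σ (leafShift α (x - α * (y + 1), 0) 1, y) = σ ((x - α * y, 0), y) :=
      transitionTime_congr hfree h (by
        simp only [torusPoint, leafShift, Prod.mk.injEq, circlePoint_eq_iff]
        exact ⟨⟨0, by push_cast; ring⟩, 1, by simp⟩) y
    have h3 := hvw (x - α * (y + 1))
    have h4 : x - α * (y + 1) + α = x - α * y := by ring
    rw [h4] at h3
    rw [h2, add_comm 1 y] at h1
    simp only [hU, h1]
    simp only [hw_def] at h3
    linarith
  have hUp : ∀ z z', torusPoint z = torusPoint z' → U z = U z' := by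
    rintro ⟨x, y⟩ ⟨x', y'⟩ hz
    simp only [torusPoint, Prod.mk.injEq, circlePoint_eq_iff] at hz
    obtain ⟨⟨m, rfl⟩, n, rfl⟩ := hz
    rw [hU1]
    simpa using (hU2' x').int_mul n y'
  set u : Circle × Circle → ℝ := fun p => U (circleAngle p.1, circleAngle p.2) with hu
  have hupi : ∀ z, u (torusPoint z) = U z := fun z => hUp _ _ (by
    simp [torusPoint, circlePoint_circleAngle])
  refine ⟨c, hc0, u, contMDiff_of_comp_torusPoint ?_, fun z t => ?_⟩
  · rw [show u ∘ torusPoint = U from funext hupi]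
    exact hUs.contMDiff
  · rw [kroneckerFlow_torusPoint_eq, hupi, hupi, hUshift]

end transition

/-- Moving each point by `ψ`-time `-u` cancels the coboundary in `σ`, leaving the linear time `c *
t`. The same conjugacy relation shows that moving by `φ`-time `u / c` is a right inverse.
Injectivity follows from freeness of `ψ`, since `F` keeps each point in its leaf. -/
theorem IsBadlyApproximable.isParameterRigid {α : ℝ} (hba : IsBadlyApproximable α) :
    (kroneckerFlow α).IsParameterRigid := by
  intro ψ horb
  obtain ⟨hfree, σ, hσ, h⟩ := exists_contDiff_transitionTime hba.irrational ψ horb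
  obtain ⟨c, hc, u, hu, huσ⟩ := exists_transfer_function hba hfree hσ h
  set φ := kroneckerFlow α with hφ
  set F : Circle × Circle → Circle × Circle := fun p => ψ.toFlow (-u p) p with hF
  set G : Circle × Circle → Circle × Circle := fun p => φ.toFlow (u p / c) p with hG
  have hconj : ∀ p t, F (φ.toFlow t p) = ψ.toFlow (c * t) (F p) := by
    intro p t
    obtain ⟨z, rfl⟩ := torusPoint_surjective p
    have h1 := huσ z t
    simp only [hF]
    rw [show -u (φ.toFlow t (torusPoint z)) = -u (torusPoint z) + c * t - σ (z, t) by linarith,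
      h z t, ← ψ.toFlow.map_add, ← ψ.toFlow.map_add]
    congr 1
    ring
  have hFG : ∀ q, F (G q) = q := by
    intro q
    simp only [hG]
    rw [hconj, hF, ← ψ.toFlow.map_add, mul_div_cancel₀ _ hc, add_neg_cancel,
      ψ.toFlow.map_zero_apply]
  have hFmem : ∀ p, ∃ t, F p = φ.toFlow t p := by
    intro p
    have := ψ.toFlow.mem_orbit p (-u p)
    rw [horb] at this
    obtain ⟨t, ht⟩ := this
    exact ⟨t, ht.symm⟩
  have hFinj : Function.Injective F := by
    intro p q hpq
    obtain ⟨s, hs⟩ := hFmem p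
    obtain ⟨t, ht⟩ := hFmem q
    have h1 : q = φ.toFlow (-t + s) p := by
      rw [φ.toFlow.map_add, ← hs, hpq, ht, ← φ.toFlow.map_add, neg_add_cancel,
        φ.toFlow.map_zero_apply]
    have h2 : ψ.toFlow (c * (-t + s)) (F p) = F p := by
      rw [← hconj, ← h1, hpq]
    have h3 : -t + s = 0 := (mul_eq_zero.1 (hfree _ _ h2)).resolve_left hc
    rw [h1, h3, φ.toFlow.map_zero_apply]
  have hGF : ∀ p, G (F p) = p := fun p => hFinj (hFG _)
  have hFs : ContMDiff ((𝓡 1).prod (𝓡 1)) ((𝓡 1).prod (𝓡 1)) ∞ F :=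
    ContMDiff.comp (g := fun p : ℝ × (Circle × Circle) => ψ.toFlow p.1 p.2) ψ.contMDiff'
      ((contDiff_neg.contMDiff.comp hu).prodMk contMDiff_id)
  have hGs : ContMDiff ((𝓡 1).prod (𝓡 1)) ((𝓡 1).prod (𝓡 1)) ∞ G :=
    ContMDiff.comp (g := fun p : ℝ × (Circle × Circle) => φ.toFlow p.1 p.2) φ.contMDiff'
      (((contDiff_id.div_const c).contMDiff.comp hu).prodMk contMDiff_id)
  refine ⟨⟨⟨F, G, hGF, hFG⟩, hFs, hGs⟩,
    { toFun := fun t => c * t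
      invFun := fun t => c⁻¹ * t
      left_inv := fun t => by simp [hc]
      right_inv := fun t => by simp [hc]
      map_add' := fun s t => mul_add c s t
      continuous_toFun := by fun_prop
      continuous_invFun := by fun_prop }, fun p => ?_, hconj⟩
  refine Set.Subset.antisymm ?_ ?_
  · rintro _ ⟨q, hq, rfl⟩
    obtain ⟨t, ht⟩ := hFmem q
    change F q ∈ _
    rw [ht]
    exact φ.toFlow.mem_orbit_of_mem_orbit t hq
  · intro q hq
    exact ⟨G q, φ.toFlow.mem_orbit_of_mem_orbit _ hq, hFG q⟩

/-! ### Flows built from cocycles, and rational slopes. -/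

theorem leafShift_zero (α : ℝ) (z : ℝ × ℝ) : leafShift α z 0 = z := by simp [leafShift]

theorem leafShift_add (α : ℝ) (z : ℝ × ℝ) (s t : ℝ) :
    leafShift α z (s + t) = leafShift α (leafShift α z s) t := by
  simp only [leafShift, Prod.mk.injEq]
  constructor <;> ring

/-- A smooth, fibrewise bijective cocycle over the Kronecker flow, given on the universal cover,
is the transition time to a smooth locally free flow with the same orbits. -/
theorem exists_flow_of_transitionTime {α : ℝ} {σ : (ℝ × ℝ) × ℝ → ℝ} (hσ : ContDiff ℝ ∞ σ)
    (hd : ∀ z t, deriv (fun t => σ (z, t)) t ≠ 0)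
    (hbij : ∀ z, Function.Bijective fun t => σ (z, t))
    (hadd : ∀ z s t, σ (z, s + t) = σ (z, s) + σ (leafShift α z s, t))
    (hper : ∀ z z' t, torusPoint z = torusPoint z' → σ (z, t) = σ (z', t)) :
    ∃ ψ : SmoothLocallyFreeFlow ((𝓡 1).prod (𝓡 1)) (Circle × Circle),
      (∀ x, ψ.toFlow.orbit x = (kroneckerFlow α).toFlow.orbit x) ∧
      ∀ z t, (kroneckerFlow α).toFlow t (torusPoint z) = ψ.toFlow (σ (z, t)) (torusPoint z) := by
  choose τ' hτ' using fun z => (hbij z).2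
  set τ : (ℝ × ℝ) × ℝ → ℝ := fun q => τ' q.1 q.2 with hτ_def
  have hτσ : ∀ z s, σ (z, τ (z, s)) = s := hτ'
  have hτ_eq : ∀ z s t, σ (z, t) = s → τ (z, s) = t := fun z s t h =>
    (hbij z).1 ((hτσ z s).trans h.symm)
  have hτ : ContDiff ℝ ∞ τ := contDiff_fiberwise_inverse hσ hd (fun z => (hbij z).1) hτσ
  have hσ0 : ∀ z, σ (z, 0) = 0 := by
    intro z
    have := hadd z 0 0
    rw [leafShift_zero, add_zero] at this
    linarith
  set φ := kroneckerFlow α with hφ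
  -- The angles pick one representative, discontinuously; `hper` makes the choice immaterial, and
  -- smoothness is checked on the cover.
  set Ψ : ℝ → Circle × Circle → Circle × Circle := fun s p =>
    φ.toFlow (τ ((circleAngle p.1, circleAngle p.2), s)) p with hΨ
  have hΨπ : ∀ z s, Ψ s (torusPoint z) = φ.toFlow (τ (z, s)) (torusPoint z) := by
    intro z s
    simp only [hΨ]
    congr 1
    refine hτ_eq _ _ _ ?_
    rw [hper _ z _ (by simp [torusPoint, circlePoint_circleAngle]), hτσ]
  have hsm : ContMDiff (𝓘(ℝ, ℝ).prod ((𝓡 1).prod (𝓡 1))) ((𝓡 1).prod (𝓡 1)) ∞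
      (fun p : ℝ × (Circle × Circle) => Ψ p.1 p.2) := by
    refine contMDiff_of_comp_prod_torusPoint ?_
    simp only [hΨπ]
    refine ContMDiff.comp (g := fun p : ℝ × (Circle × Circle) => φ.toFlow p.1 p.2) φ.contMDiff'
      (ContMDiff.prodMk ?_ (contMDiff_torusPoint.comp contDiff_snd.contMDiff))
    exact (hτ.comp (contDiff_snd.prodMk contDiff_fst)).contMDiff
  let ψ : SmoothLocallyFreeFlow ((𝓡 1).prod (𝓡 1)) (Circle × Circle) :=
    { toFun := Ψ
      cont' := hsm.continuous
      map_add' := by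
        intro s t p
        obtain ⟨z, rfl⟩ := torusPoint_surjective p
        rw [hΨπ z t, kroneckerFlow_torusPoint_eq, hΨπ, hΨπ, kroneckerFlow_torusPoint_eq,
          kroneckerFlow_torusPoint_eq, ← leafShift_add]
        congr 2
        refine hτ_eq _ _ _ ?_
        rw [hadd, hτσ, hτσ, add_comm]
      map_zero' := by
        intro p
        obtain ⟨z, rfl⟩ := torusPoint_surjective p
        rw [hΨπ, hτ_eq _ _ _ (hσ0 z), φ.toFlow.map_zero_apply]
      contMDiff' := hsm
      locallyFree' := by
        intro p
        obtain ⟨z, rfl⟩ := torusPoint_surjective p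
        have hc : Filter.Tendsto (fun s => τ (z, s)) (𝓝[≠] 0) (𝓝[≠] 0) := by
          refine tendsto_nhdsWithin_iff.2 ⟨?_, ?_⟩
          · have h1 : Continuous fun s => τ (z, s) := hτ.continuous.comp (by fun_prop)
            have h2 := h1.tendsto 0
            rw [hτ_eq _ _ _ (hσ0 z)] at h2
            exact h2.mono_left nhdsWithin_le_nhds
          · filter_upwards [self_mem_nhdsWithin] with s hs h0
            refine hs ?_
            rw [Set.mem_singleton_iff] at h0 ⊢
            rw [← hτσ z s, h0, hσ0]
        filter_upwards [hc.eventually (φ.locallyFree' (torusPoint z))] with s hs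
        rw [hΨπ]
        exact hs }
  have hψ : ∀ z t, φ.toFlow t (torusPoint z) = ψ.toFlow (σ (z, t)) (torusPoint z) := by
    intro z t
    change _ = Ψ _ _
    rw [hΨπ, hτ_eq z (σ (z, t)) t rfl]
  refine ⟨ψ, fun p => ?_, hψ⟩
  obtain ⟨z, rfl⟩ := torusPoint_surjective p
  refine Set.Subset.antisymm ?_ ?_
  · rintro _ ⟨s, rfl⟩
    exact ⟨τ (z, s), (hΨπ z s).symm⟩
  · rintro _ ⟨t, rfl⟩
    exact ⟨σ (z, t), (hψ z t).symm⟩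

/-- The function `f` is constant on orbits, so `t * f z` is a cocycle. Since `φ` has period `k`
everywhere, a conjugacy makes `A k` a period of `ψ` at every point. Then `A k / f z` is always an
integer, hence constant by continuity, although `f` takes the values `3` and `1`; so `A k = 0`,
which is absurd. -/
theorem kroneckerFlow_not_isParameterRigid_of_rational {α : ℝ} {k m : ℤ} (hk : k ≠ 0)
    (hm : k * α = m) : ¬ (kroneckerFlow α).IsParameterRigid := by
  intro hrig
  set f : ℝ × ℝ → ℝ := fun z => 2 + Real.cos (2 * Real.pi * (k * z.1 - m * z.2)) with hf
  have hfs : ContDiff ℝ ∞ f := by fun_prop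
  have hf1 : ∀ z, 0 < f z := fun z => by
    have := Real.neg_one_le_cos (2 * Real.pi * (k * z.1 - m * z.2))
    simp only [hf]
    linarith
  have hfshift : ∀ z t, f (leafShift α z t) = f z := by
    intro z t
    simp only [hf, leafShift]
    congr 3
    linear_combination t * hm
  have hfper : ∀ z z', torusPoint z = torusPoint z' → f z = f z' := by
    rintro ⟨x, y⟩ ⟨x', y'⟩ hz
    simp only [torusPoint, Prod.mk.injEq, circlePoint_eq_iff] at hz
    obtain ⟨⟨a, rfl⟩, b, rfl⟩ := hz
    simp only [hf]
    rw [← Real.cos_add_int_mul_two_pi (2 * Real.pi * (k * x' - m * y')) (k * a - m * b)]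
    congr 2
    push_cast
    ring
  obtain ⟨ψ, horb, hψ⟩ := exists_flow_of_transitionTime (α := α)
    (σ := fun q => q.2 * f q.1) (contDiff_snd.mul (hfs.comp contDiff_fst))
    (fun z t => by
      rw [show deriv (fun t => t * f z) t = f z from (hasDerivAt_mul_const (f z)).deriv]
      exact (hf1 z).ne')
    (fun z => ⟨fun s t h => mul_right_cancel₀ (hf1 z).ne' h,
      fun t => ⟨t / f z, div_mul_cancel₀ _ (hf1 z).ne'⟩⟩)
    (fun z s t => by simp only [hfshift]; ring)
    (fun z z' t h => by simp only [hfper z z' h])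
  obtain ⟨F, A, -, hFA⟩ := hrig ψ horb
  have hper : ∀ p, (kroneckerFlow α).toFlow k p = p := by
    intro p
    obtain ⟨z, rfl⟩ := torusPoint_surjective p
    rw [kroneckerFlow_torusPoint, torusPoint, torusPoint, Prod.mk.injEq, circlePoint_eq_iff,
      circlePoint_eq_iff]
    exact ⟨⟨m, by linear_combination hm⟩, k, rfl⟩
  have hψper : ∀ q, ψ.toFlow (A k) q = q := by
    intro q
    have := hFA (F.symm q) k
    rw [hper, F.apply_symm_apply] at this
    exact this.symm
  have hinteg : ∀ z, ∃ n : ℤ, A k / f z = n := by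
    intro z
    have h1 := hψ z (A k / f z)
    simp only [div_mul_cancel₀ _ (hf1 z).ne', hψper] at h1
    rw [kroneckerFlow_torusPoint, torusPoint, torusPoint, Prod.mk.injEq, circlePoint_eq_iff,
      circlePoint_eq_iff] at h1
    obtain ⟨-, n, hn⟩ := h1
    exact ⟨n, by linarith⟩
  have hk' : (k : ℝ) ≠ 0 := by exact_mod_cast hk
  have hconst := Continuous.eq_of_range_subset_countable (g := fun z => A k / f z)
    (continuous_const.div hfs.continuous fun z => (hf1 z).ne') (s := Set.range ((↑) : ℤ → ℝ))
    (Set.countable_range _) (fun z => (hinteg z).imp fun n hn => hn.symm) (0, 0) (1 / (2 * k), 0)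
  have hf0 : f (0, 0) = 3 := by
    simp only [hf]
    norm_num
  have hf2 : f (1 / (2 * k), 0) = 1 := by
    simp only [hf]
    rw [show 2 * Real.pi * (k * (1 / (2 * k)) - m * 0) = Real.pi by field_simp; ring, Real.cos_pi]
    norm_num
  simp only [hf0, hf2] at hconst
  have hA : A k = 0 := by linarith
  rw [map_eq_zero_iff A A.injective] at hA
  exact hk' hA

/-! ### Irrational slopes that are not badly approximable. -/

section liouville

/-- Only finitely many `k` compete, and none gives distance zero. This forces good approximations to
have large denominators. -/
theorem exists_pos_le_norm_mul {α : ℝ} (hα : Irrational α) (N : ℕ) :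
    ∃ δ > (0 : ℝ), ∀ k : ℤ, k ≠ 0 → k.natAbs ≤ N → δ ≤ ‖((k * α : ℝ) : UnitAddCircle)‖ := by
  have hne : ∀ k : ℤ, k ≠ 0 → 0 < ‖((k * α : ℝ) : UnitAddCircle)‖ := by
    intro k hk
    rw [UnitAddCircle.norm_eq, abs_pos, sub_ne_zero]
    exact fun h => (hα.intCast_mul hk) ⟨round ((k : ℝ) * α), by rw [Rat.cast_intCast, ← h]⟩
  have hfin : {k : ℤ | k ≠ 0 ∧ k.natAbs ≤ N}.Finite :=
    (Set.finite_Icc (-(N : ℤ)) N).subset fun k hk => by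
      have := hk.2
      simp only [Set.mem_Icc]
      omega
  rcases Set.eq_empty_or_nonempty {k : ℤ | k ≠ 0 ∧ k.natAbs ≤ N} with he | hn
  · exact ⟨1, one_pos, fun k hk hkN => absurd (show k ∈ (∅ : Set ℤ) from he ▸ ⟨hk, hkN⟩)
      (Set.notMem_empty k)⟩
  · obtain ⟨k₀, hk₀, hmin⟩ := Set.exists_min_image _
      (fun k : ℤ => ‖((k * α : ℝ) : UnitAddCircle)‖) hfin hn
    exact ⟨_, hne k₀ hk₀.1, fun k hk hkN => hmin k ⟨hk, hkN⟩⟩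

/-- An irrational number that is not badly approximable has denominators with super-polynomially
small errors. -/
theorem exists_liouville_sequence {α : ℝ} (hα : Irrational α) (hba : ¬ IsBadlyApproximable α) :
    ∃ k : ℕ → ℕ, StrictMono k ∧ ∀ j, 1 ≤ k j ∧
      |(k j : ℝ) * α - round ((k j : ℝ) * α)| * (k j : ℝ) ^ j ≤ (1 / 2) ^ j / 32 := by
  refine Filter.extraction_forall_of_frequently (P := fun j k : ℕ => 1 ≤ k ∧
      |(k : ℝ) * α - round ((k : ℝ) * α)| * (k : ℝ) ^ j ≤ (1 / 2) ^ j / 32) fun j => ?_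
  rw [Filter.frequently_atTop]
  intro N
  obtain ⟨δ, hδ, hδN⟩ := exists_pos_le_norm_mul hα N
  simp only [IsBadlyApproximable, not_exists, not_and, not_forall, not_lt, exists_prop, gt_iff_lt]
    at hba
  -- The bound `δ / 2` excludes every `|k| ≤ N`; the other one is the estimate wanted. The exponent
  -- `j + 1` below is positive even for `j = 0`, and its surplus factor `1 / |k|` is discarded.
  set C : ℝ := min (δ / 2) ((1 / 2) ^ j / 32) with hC
  have hC0 : 0 < C := lt_min (by positivity) (by positivity)
  obtain ⟨k, hk, hkC⟩ := hba C hC0 ((j + 1 : ℕ) : ℝ) (by positivity)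
  have hk1 : (1 : ℝ) ≤ |(k : ℝ)| := by exact_mod_cast Int.one_le_abs hk
  have hk0 : (0 : ℝ) < |(k : ℝ)| := by linarith
  rw [Real.rpow_neg hk0.le, Real.rpow_natCast, ← div_eq_mul_inv] at hkC
  have h1 : ‖((k * α : ℝ) : UnitAddCircle)‖ ≤ C :=
    hkC.trans (div_le_self hC0.le (one_le_pow₀ hk1))
  have h2 : N < k.natAbs := by
    by_contra! hle
    have := hδN k hk hle
    have : C ≤ δ / 2 := min_le_left _ _
    linarith
  have hcast : ((k.natAbs : ℕ) : ℝ) = |(k : ℝ)| := by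
    rw [Nat.cast_natAbs, Int.cast_abs]
  have h3 : |(k.natAbs : ℝ) * α - round ((k.natAbs : ℝ) * α)| =
      ‖((k * α : ℝ) : UnitAddCircle)‖ := by
    rw [← UnitAddCircle.norm_eq, hcast]
    rcases abs_choice (k : ℝ) with h | h
    · rw [h]
    · rw [h, neg_mul, AddCircle.coe_neg, norm_neg]
  refine ⟨k.natAbs, h2.le, by omega, ?_⟩
  rw [h3, hcast]
  calc _ ≤ C / |(k : ℝ)| ^ (j + 1) * |(k : ℝ)| ^ j := by gcongr
    _ = C / |(k : ℝ)| := by rw [pow_succ]; field_simp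
    _ ≤ C := div_le_self hC0.le hk1
    _ ≤ _ := min_le_right _ _

variable {k : ℕ → ℕ} {ε : ℕ → ℝ}

theorem norm_iteratedFDeriv_mul_sin_le (c : ℝ) (L : ℝ × ℝ →L[ℝ] ℝ) (n : ℕ) (q : ℝ × ℝ) :
    ‖iteratedFDeriv ℝ n (fun q => c * Real.sin (L q)) q‖ ≤ |c| * ‖L‖ ^ n := by
  have h0 : ContDiff ℝ ∞ fun q => Real.sin (L q) := Real.contDiff_sin.comp L.contDiff
  have h1 : (fun q => c * Real.sin (L q)) = c • fun q => Real.sin (L q) := rfl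
  rw [h1, iteratedFDeriv_const_smul_apply (h0.of_le (by exact_mod_cast le_top)).contDiffAt,
    norm_smul, Real.norm_eq_abs]
  gcongr
  have h2 := L.iteratedFDeriv_comp_right (f := Real.sin) Real.contDiff_sin q
    (i := n) (n := ∞) (by exact_mod_cast le_top)
  change ‖iteratedFDeriv ℝ n (Real.sin ∘ L) q‖ ≤ _
  rw [h2]
  refine (ContinuousMultilinearMap.norm_compContinuousLinearMap_le _ _).trans ?_
  rw [norm_iteratedFDeriv_eq_norm_iteratedDeriv, Finset.prod_const, Finset.card_fin]
  exact mul_le_of_le_one_left (by positivity) (Real.abs_iteratedDeriv_sin_le_one n _)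

theorem abs_le_of_liouville (hk : ∀ j, 1 ≤ k j)
    (hε : ∀ j, |ε j| * (k j : ℝ) ^ j ≤ (1 / 2) ^ j / 32) (j : ℕ) : |ε j| ≤ (1 / 2) ^ j / 32 := by
  have h1 : (1 : ℝ) ≤ (k j : ℝ) ^ j := one_le_pow₀ (by exact_mod_cast hk j)
  nlinarith [hε j, abs_nonneg (ε j)]

/-- The perturbation of the generator of the Kronecker flow, in coordinates `(x - α y, y)`. -/
noncomputable def liouvilleSeries (k : ℕ → ℕ) (ε : ℕ → ℝ) (q : ℝ × ℝ) : ℝ :=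
  -- Each term is the `y`-derivative of `cos (2π (k j * q.1 + ε j * q.2))`, that is, the derivative
  -- along the flow.
  ∑' j, -(2 * Real.pi * ε j) * Real.sin (2 * Real.pi * (k j * q.1 + ε j * q.2))

theorem summable_liouville_bound : Summable fun j : ℕ => 2 * Real.pi * ((1 / 2 : ℝ) ^ j / 32) :=
  (summable_geometric_two.div_const 32).mul_left _

theorem norm_liouville_term_le (hk : ∀ j, 1 ≤ k j)
    (hε : ∀ j, |ε j| * (k j : ℝ) ^ j ≤ (1 / 2) ^ j / 32) (j : ℕ) (x : ℝ) :
    ‖-(2 * Real.pi * ε j) * Real.sin x‖ ≤ 2 * Real.pi * ((1 / 2 : ℝ) ^ j / 32) := by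
  have hp := Real.pi_pos
  rw [norm_mul, norm_neg, norm_mul, Real.norm_of_nonneg (by positivity : 0 ≤ 2 * Real.pi),
    Real.norm_eq_abs, Real.norm_eq_abs]
  calc 2 * Real.pi * |ε j| * |Real.sin x| ≤ 2 * Real.pi * |ε j| * 1 := by
        gcongr
        exact Real.abs_sin_le_one x
    _ ≤ _ := by
        rw [mul_one]
        gcongr
        exact abs_le_of_liouville hk hε j

theorem hasSum_liouvilleSeries (hk : ∀ j, 1 ≤ k j)
    (hε : ∀ j, |ε j| * (k j : ℝ) ^ j ≤ (1 / 2) ^ j / 32) (q : ℝ × ℝ) :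
    HasSum (fun j => -(2 * Real.pi * ε j) * Real.sin (2 * Real.pi * (k j * q.1 + ε j * q.2)))
      (liouvilleSeries k ε q) :=
  (summable_liouville_bound.of_norm_bounded fun j => norm_liouville_term_le hk hε j _).hasSum

/-- The factor `1 / 32` gives the total `4π / 32`, below `1 / 2`; this keeps the generator `1 + b`
positive. -/
theorem abs_liouvilleSeries_le (hk : ∀ j, 1 ≤ k j)
    (hε : ∀ j, |ε j| * (k j : ℝ) ^ j ≤ (1 / 2) ^ j / 32) (q : ℝ × ℝ) :
    |liouvilleSeries k ε q| ≤ 1 / 2 := by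
  have h1 := tsum_of_norm_bounded
    ((hasSum_geometric_two.div_const 32).mul_left (2 * Real.pi))
    (fun j => norm_liouville_term_le hk hε j (2 * Real.pi * (k j * q.1 + ε j * q.2)))
  have h2 := Real.pi_lt_four
  rw [Real.norm_eq_abs] at h1
  refine h1.trans ?_
  linarith

theorem contDiff_liouvilleSeries (hk : ∀ j, 1 ≤ k j)
    (hε : ∀ j, |ε j| * (k j : ℝ) ^ j ≤ (1 / 2) ^ j / 32) : ContDiff ℝ ∞ (liouvilleSeries k ε) := by
  have hp := Real.pi_pos
  let L : ℕ → ℝ × ℝ →L[ℝ] ℝ := fun j => (2 * Real.pi) •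
    ((k j : ℝ) • ContinuousLinearMap.fst ℝ ℝ ℝ + ε j • ContinuousLinearMap.snd ℝ ℝ ℝ)
  have hLapp : ∀ j q, L j q = 2 * Real.pi * (k j * q.1 + ε j * q.2) := fun j q => by
    simp only [L, smul_apply, add_apply,
      ContinuousLinearMap.coe_fst', ContinuousLinearMap.coe_snd', smul_eq_mul]
  have hL : ∀ j, ‖L j‖ ≤ 4 * Real.pi * k j := by
    intro j
    have h1 : (1 : ℝ) ≤ k j := by exact_mod_cast hk j
    have h2 : |ε j| ≤ 1 := (abs_le_of_liouville hk hε j).trans (by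
      have : (1 / 2 : ℝ) ^ j ≤ 1 := pow_le_one₀ (by norm_num) (by norm_num)
      linarith)
    refine ContinuousLinearMap.opNorm_le_bound _ (by positivity) fun q => ?_
    rw [hLapp, norm_mul, Real.norm_of_nonneg (by positivity : 0 ≤ 2 * Real.pi)]
    have h3 : ‖(k j : ℝ) * q.1 + ε j * q.2‖ ≤ 2 * k j * ‖q‖ := by
      refine (norm_add_le _ _).trans ?_
      rw [norm_mul, norm_mul, Real.norm_natCast, Real.norm_eq_abs (ε j)]
      have h4 := norm_fst_le q
      have h5 := norm_snd_le q
      have h6 : (k j : ℝ) * ‖q.1‖ ≤ k j * ‖q‖ := by gcongr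
      have h7 : |ε j| * ‖q.2‖ ≤ k j * ‖q‖ := by
        gcongr
        linarith
      linarith
    calc _ ≤ 2 * Real.pi * (2 * k j * ‖q‖) := by gcongr
      _ = _ := by ring
  have hterm : liouvilleSeries k ε =
      fun q => ∑' j, -(2 * Real.pi * ε j) * Real.sin (L j q) := by
    ext q
    simp only [liouvilleSeries, hLapp]
  rw [hterm]
  refine contDiff_tsum_of_eventually (N := ⊤)
    (v := fun n j => (4 * Real.pi) ^ n * (2 * Real.pi * ((1 / 2 : ℝ) ^ j / 32)))
    (fun j => contDiff_const.mul (Real.contDiff_sin.comp (L j).contDiff))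
    (fun n _ => summable_liouville_bound.mul_left _) ?_
  intro n _
  rw [Nat.cofinite_eq_atTop]
  -- An `n`-th derivative costs `k j ^ n`, which the smallness of `ε j` absorbs once `j ≥ n`; the
  -- finitely many earlier terms do not matter.
  filter_upwards [Filter.eventually_ge_atTop n] with j hj q
  refine (norm_iteratedFDeriv_mul_sin_le _ _ _ _).trans ?_
  have h1 : (1 : ℝ) ≤ k j := by exact_mod_cast hk j
  rw [abs_neg, abs_mul, abs_of_pos (by positivity : 0 < 2 * Real.pi)]
  calc 2 * Real.pi * |ε j| * ‖L j‖ ^ n ≤ 2 * Real.pi * |ε j| * (4 * Real.pi * k j) ^ n := by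
        gcongr
        exact hL j
    _ = (4 * Real.pi) ^ n * (2 * Real.pi * (|ε j| * (k j : ℝ) ^ n)) := by ring
    _ ≤ (4 * Real.pi) ^ n * (2 * Real.pi * (|ε j| * (k j : ℝ) ^ j)) := by gcongr
    _ ≤ _ := by
        gcongr
        exact hε j

theorem liouvilleSeries_add_intCast (k : ℕ → ℕ) (ε : ℕ → ℝ) (ξ y : ℝ) (n : ℤ) :
    liouvilleSeries k ε (ξ + n, y) = liouvilleSeries k ε (ξ, y) := by
  refine tsum_congr fun j => ?_
  rw [← Real.sin_add_int_mul_two_pi (2 * Real.pi * (k j * (ξ, y).1 + ε j * (ξ, y).2)) (k j * n)]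
  congr 2
  push_cast
  ring

/-- In the coordinates `(x - α y, y)` this is the deck transformation `y ↦ y + n`; it changes the
phase by `2π` times the integer `-(m * n)`. -/
theorem liouvilleSeries_sub_add {α : ℝ} (hε : ∀ j, ∃ m : ℤ, ε j = k j * α - m) (ξ y : ℝ) (n : ℤ) :
    liouvilleSeries k ε (ξ - α * n, y + n) = liouvilleSeries k ε (ξ, y) := by
  refine tsum_congr fun j => ?_
  obtain ⟨m, hm⟩ := hε j
  rw [← Real.sin_add_int_mul_two_pi (2 * Real.pi * (k j * (ξ, y).1 + ε j * (ξ, y).2)) (-(m * n))]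
  congr 2
  push_cast
  linear_combination 2 * Real.pi * n * hm

/-- Each term integrates exactly. When `ε j` is congruent to `k j * α` modulo `1`, the result is the
coboundary of `cos (2π k j x)` under the rotation. -/
theorem hasSum_integral_liouvilleSeries (hk : ∀ j, 1 ≤ k j)
    (hε : ∀ j, |ε j| * (k j : ℝ) ^ j ≤ (1 / 2) ^ j / 32) (x : ℝ) :
    HasSum (fun j => Real.cos (2 * Real.pi * (k j * x + ε j)) - Real.cos (2 * Real.pi * (k j * x)))
      (∫ r in (0 : ℝ)..1, liouvilleSeries k ε (x, r)) := by
  have h := intervalIntegral.hasSum_integral_of_dominated_convergence (a := (0 : ℝ)) (b := 1)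
    (μ := MeasureTheory.volume)
    (F := fun j r => -(2 * Real.pi * ε j) * Real.sin (2 * Real.pi * (k j * x + ε j * r)))
    (f := fun r => liouvilleSeries k ε (x, r))
    (fun j _ => 2 * Real.pi * ((1 / 2 : ℝ) ^ j / 32))
    (fun j => Continuous.aestronglyMeasurable (by fun_prop))
    (fun j => Filter.Eventually.of_forall fun r _ => norm_liouville_term_le hk hε j _)
    (Filter.Eventually.of_forall fun r _ => summable_liouville_bound)
    intervalIntegrable_const
    (Filter.Eventually.of_forall fun r _ => hasSum_liouvilleSeries hk hε (x, r))
  have hj : ∀ j, ∫ r in (0 : ℝ)..1,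
      -(2 * Real.pi * ε j) * Real.sin (2 * Real.pi * (k j * x + ε j * r)) =
      Real.cos (2 * Real.pi * (k j * x + ε j)) - Real.cos (2 * Real.pi * (k j * x)) := by
    intro j
    have hd : ∀ r ∈ Set.uIcc (0 : ℝ) 1,
        HasDerivAt (fun r => Real.cos (2 * Real.pi * (k j * x + ε j * r)))
          (-(2 * Real.pi * ε j) * Real.sin (2 * Real.pi * (k j * x + ε j * r))) r := by
      intro r _
      have := (((hasDerivAt_const_mul (ε j) (x := r)).const_add (k j * x)).const_mul
        (2 * Real.pi)).cos
      convert this using 1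
      ring
    rw [intervalIntegral.integral_eq_sub_of_hasDerivAt hd
      (Continuous.intervalIntegrable (by fun_prop) _ _)]
    simp
  simpa only [hj] using h

end liouville

theorem periodicFourierCoeff_sub {f g : ℝ → ℂ} (hf : Continuous f) (hg : Continuous g) (k : ℤ) :
    periodicFourierCoeff (fun x => f x - g x) k =
      periodicFourierCoeff f k - periodicFourierCoeff g k := by
  have hc := continuous_fourier_unitAddCircle (-k)
  simp only [periodicFourierCoeff, mul_sub]
  exact intervalIntegral.integral_sub ((hc.mul hf).intervalIntegrable _ _)
    ((hc.mul hg).intervalIntegrable _ _)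

theorem periodicFourierCoeff_const {k : ℤ} (hk : k ≠ 0) (c : ℂ) :
    periodicFourierCoeff (fun _ => c) k = 0 := by
  have h := periodicFourierCoeff_fourier 0 k
  rw [if_neg hk] at h
  simp only [periodicFourierCoeff, fourier_zero, mul_one] at h
  rw [periodicFourierCoeff, intervalIntegral.integral_mul_const, h, zero_mul]

theorem fourier_sub_one_ne_zero_of_irrational {α : ℝ} (hα : Irrational α) {k : ℤ} (hk : k ≠ 0) :
    (fourier k (α : UnitAddCircle) : ℂ) - 1 ≠ 0 := by
  obtain ⟨δ, hδ, h⟩ := exists_pos_le_norm_mul hα k.natAbs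
  exact norm_pos_iff.1 (hδ.trans_le ((h k hk le_rfl).trans (norm_le_norm_fourier_sub_one k α)))

section liouville

variable {α : ℝ} {k : ℕ → ℕ} {ε : ℕ → ℝ}

/-- The Fourier coefficients of a solution of the cohomological equation for the Liouville series
would be `1 / 2` at infinitely many places. -/
theorem periodicFourierCoeff_transfer (hα : Irrational α) (hkm : StrictMono k) (hk : ∀ j, 1 ≤ k j)
    (hε : ∀ j, |ε j| * (k j : ℝ) ^ j ≤ (1 / 2) ^ j / 32)
    (hεα : ∀ j, ∃ m : ℤ, ε j = k j * α - m) {u : ℝ → ℝ} (hu : Continuous u)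
    (hup : Function.Periodic u 1) {c : ℝ}
    (h : ∀ x, 1 + ∫ r in (0 : ℝ)..1, liouvilleSeries k ε (x, r) = c + u (x + α) - u x) (i : ℕ) :
    periodicFourierCoeff (fun x => (u x : ℂ)) (k i) = 1 / 2 := by
  have hk0 : (k i : ℤ) ≠ 0 := by
    have := hk i
    omega
  set e : ℂ := fourier (k i : ℤ) (α : UnitAddCircle) with he
  have he1 : e - 1 ≠ 0 := fourier_sub_one_ne_zero_of_irrational hα hk0
  have huc : Continuous fun x => (u x : ℂ) := Complex.continuous_ofReal.comp hu
  have hupc : Function.Periodic (fun x => (u x : ℂ)) 1 := fun x => by simp only [hup x]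
  set D : ℕ → ℝ → ℂ := fun j x =>
    (Real.cos (2 * Real.pi * (k j * (x + α))) : ℂ) - Real.cos (2 * Real.pi * (k j * x)) with hD
  have hDeq : ∀ j (x : ℝ), D j x = ((Real.cos (2 * Real.pi * (k j * x + ε j)) -
      Real.cos (2 * Real.pi * (k j * x)) : ℝ) : ℂ) := by
    intro j x
    obtain ⟨m, hm⟩ := hεα j
    have : Real.cos (2 * Real.pi * (k j * (x + α))) =
        Real.cos (2 * Real.pi * (k j * x + ε j)) := by
      rw [← Real.cos_add_int_mul_two_pi (2 * Real.pi * (k j * x + ε j)) m]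
      congr 1
      linear_combination -2 * Real.pi * hm
    simp only [hD, this]
    push_cast
    rfl
  -- Strict monotonicity of `k` isolates one frequency: only the term `j = i` has a coefficient at
  -- `k i`, with the divisor `e - 1` as a factor. That factor cancels at the end.
  have hDc : ∀ j, periodicFourierCoeff (D j) (k i) = if j = i then (e - 1) / 2 else 0 := by
    intro j
    have hcos : Continuous fun x : ℝ => (Real.cos (2 * Real.pi * (k j * x)) : ℂ) :=
      Complex.continuous_ofReal.comp (by fun_prop)
    have hcosp : Function.Periodic (fun x : ℝ => (Real.cos (2 * Real.pi * (k j * x)) : ℂ)) 1 := by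
      intro x
      simp only
      rw [← Real.cos_add_int_mul_two_pi (2 * Real.pi * (k j * x)) (k j)]
      congr 2
      push_cast
      ring
    have h1 := periodicFourierCoeff_comp_add hcosp α (k i)
    have h2 := periodicFourierCoeff_sub (hcos.comp (continuous_add_const α)) hcos (k i)
    have h3 := periodicFourierCoeff_cos (hk j) (hk i)
    simp only [Function.comp_def] at h2
    simp only [hD]
    rw [h2, h1, h3, ← he]
    by_cases hji : j = i
    · rw [if_pos (by rw [hji]), if_pos hji]
      ring
    · rw [if_neg (fun h => hji (hkm.injective h.symm)), if_neg hji]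
      ring
  have hW : ∀ x : ℝ, HasSum (fun j => D j x)
      (((u (x + α) : ℝ) : ℂ) - (u x : ℂ) - ((1 - c : ℝ) : ℂ)) := by
    intro x
    have h1 := Complex.hasSum_ofReal.2 (hasSum_integral_liouvilleSeries hk hε x)
    have h2 : ∫ r in (0 : ℝ)..1, liouvilleSeries k ε (x, r) = u (x + α) - u x - (1 - c) := by
      linarith [h x]
    rw [h2] at h1
    simp only [hDeq]
    push_cast at h1 ⊢
    exact h1
  have hDbound : ∀ j (x : ℝ), ‖D j x‖ ≤ 2 * Real.pi * ((1 / 2 : ℝ) ^ j / 32) := by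
    intro j x
    have hp := Real.pi_pos
    rw [hDeq, Complex.norm_real, Real.norm_eq_abs]
    refine (Real.abs_cos_sub_cos_le _ _).trans ?_
    rw [show 2 * Real.pi * (k j * x + ε j) - 2 * Real.pi * (k j * x) = 2 * Real.pi * ε j by ring,
      abs_mul, abs_of_pos (by positivity : 0 < 2 * Real.pi)]
    gcongr
    exact abs_le_of_liouville hk hε j
  have hDcont : ∀ j, Continuous (D j) := fun j =>
    (Complex.continuous_ofReal.comp (by fun_prop)).sub
      (Complex.continuous_ofReal.comp (by fun_prop))
  have hsum := intervalIntegral.hasSum_integral_of_dominated_convergence (a := (0 : ℝ)) (b := 1)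
    (μ := MeasureTheory.volume)
    (F := fun j x => (fourier (-(k i : ℤ)) (x : UnitAddCircle) : ℂ) * D j x)
    (f := fun x => (fourier (-(k i : ℤ)) (x : UnitAddCircle) : ℂ) *
      (((u (x + α) : ℝ) : ℂ) - (u x : ℂ) - ((1 - c : ℝ) : ℂ)))
    (fun j _ => 2 * Real.pi * ((1 / 2 : ℝ) ^ j / 32))
    (fun j => ((continuous_fourier_unitAddCircle _).mul (hDcont j)).aestronglyMeasurable)
    (fun j => Filter.Eventually.of_forall fun x _ => by
      rw [norm_mul, norm_fourier_unitAddCircle, one_mul]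
      exact hDbound j x)
    (Filter.Eventually.of_forall fun x _ => summable_liouville_bound)
    intervalIntegrable_const
    (Filter.Eventually.of_forall fun x _ => (hW x).mul_left _)
  have hsum' : HasSum (fun j => periodicFourierCoeff (D j) (k i))
      (periodicFourierCoeff (fun x => ((u (x + α) : ℝ) : ℂ) - (u x : ℂ) - ((1 - c : ℝ) : ℂ))
        (k i)) := hsum
  simp only [hDc] at hsum'
  have h4 := hsum'.unique (hasSum_ite_eq i ((e - 1) / 2))
  have hua : Continuous fun x => ((u (x + α) : ℝ) : ℂ) :=
    huc.comp (continuous_id.add continuous_const)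
  rw [periodicFourierCoeff_sub (f := fun x => ((u (x + α) : ℝ) : ℂ) - (u x : ℂ)) (hua.sub huc)
    continuous_const, periodicFourierCoeff_const hk0,
    periodicFourierCoeff_sub hua huc, periodicFourierCoeff_comp_add hupc, ← he, sub_zero] at h4
  have h5 : (e - 1) * (periodicFourierCoeff (fun x => (u x : ℂ)) (k i) - 1 / 2) = 0 := by
    linear_combination h4
  exact sub_eq_zero.1 ((mul_eq_zero.1 h5).resolve_left he1)

theorem no_continuous_transfer (hα : Irrational α) (hkm : StrictMono k) (hk : ∀ j, 1 ≤ k j)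
    (hε : ∀ j, |ε j| * (k j : ℝ) ^ j ≤ (1 / 2) ^ j / 32)
    (hεα : ∀ j, ∃ m : ℤ, ε j = k j * α - m) {u : ℝ → ℝ} (hu : Continuous u)
    (hup : Function.Periodic u 1) {c : ℝ} :
    ¬ ∀ x, 1 + ∫ r in (0 : ℝ)..1, liouvilleSeries k ε (x, r) = c + u (x + α) - u x := by
  intro h
  have h1 := tendsto_periodicFourierCoeff (f := fun x => (u x : ℂ))
    (Complex.continuous_ofReal.comp hu) (fun x => by simp only [hup x])
  have h2 : Function.Injective fun j => (k j : ℤ) := fun i j hij =>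
    hkm.injective (Int.ofNat_injective hij)
  have h3 := h1.comp h2.tendsto_cofinite
  have h4 : (periodicFourierCoeff fun x => (u x : ℂ)) ∘ (fun j => (k j : ℤ)) = fun _ => 1 / 2 :=
    funext fun i => periodicFourierCoeff_transfer hα hkm hk hε hεα hu hup h i
  rw [h4] at h3
  have := tendsto_nhds_unique h3 tendsto_const_nhds
  norm_num at this

end liouville

/-- Every smooth function `b` with `|b| ≤ 1 / 2`, written in the coordinates `(x - α y, y)`, that is
invariant under deck transformations, defines a time change of the Kronecker flow. -/
theorem exists_flow_of_generator {α : ℝ} {b : ℝ × ℝ → ℝ} (hb : ContDiff ℝ ∞ b)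
    (hbound : ∀ q, |b q| ≤ 1 / 2) (hb1 : ∀ ξ y, ∀ n : ℤ, b (ξ + n, y) = b (ξ, y))
    (hb2 : ∀ ξ y, ∀ n : ℤ, b (ξ - α * n, y + n) = b (ξ, y)) :
    ∃ (ψ : SmoothLocallyFreeFlow ((𝓡 1).prod (𝓡 1)) (Circle × Circle)) (σ : (ℝ × ℝ) × ℝ → ℝ),
      (∀ x, ψ.toFlow.orbit x = (kroneckerFlow α).toFlow.orbit x) ∧ Continuous σ ∧
      (∀ x, σ ((x, 0), 1) = 1 + ∫ r in (0 : ℝ)..1, b (x, r)) ∧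
      ∀ z t, (kroneckerFlow α).toFlow t (torusPoint z) = ψ.toFlow (σ (z, t)) (torusPoint z) := by
  have hbc : ∀ ξ, Continuous fun r => b (ξ, r) := fun ξ => hb.continuous.comp (by fun_prop)
  have hbi : ∀ ξ y y', IntervalIntegrable (fun r => b (ξ, r)) MeasureTheory.volume y y' :=
    fun ξ y y' => (hbc ξ).intervalIntegrable _ _
  -- This is `t` plus the integral of `b` over the leaf segment, written with two primitives so that
  -- smoothness in all variables is visible.
  set σ : (ℝ × ℝ) × ℝ → ℝ := fun q => q.2 + ((∫ r in (0 : ℝ)..(q.1.2 + q.2),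
    b (q.1.1 - α * q.1.2, r)) - ∫ r in (0 : ℝ)..q.1.2, b (q.1.1 - α * q.1.2, r)) with hσ_def
  have hσ_eq : ∀ z t, σ (z, t) = t + ∫ r in z.2..(z.2 + t), b (z.1 - α * z.2, r) := by
    intro z t
    simp only [hσ_def]
    rw [intervalIntegral.integral_interval_sub_left (hbi _ _ _) (hbi _ _ _)]
  have hσ : ContDiff ℝ ∞ σ := by
    have hΘ := contDiff_primitive hb
    have h1 : ContDiff ℝ ∞ fun q : (ℝ × ℝ) × ℝ =>
        ∫ r in (0 : ℝ)..(q.1.2 + q.2), b (q.1.1 - α * q.1.2, r) :=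
      hΘ.comp (f := fun q : (ℝ × ℝ) × ℝ => (q.1.1 - α * q.1.2, q.1.2 + q.2)) (by fun_prop)
    have h2 : ContDiff ℝ ∞ fun q : (ℝ × ℝ) × ℝ =>
        ∫ r in (0 : ℝ)..q.1.2, b (q.1.1 - α * q.1.2, r) :=
      hΘ.comp (f := fun q : (ℝ × ℝ) × ℝ => (q.1.1 - α * q.1.2, q.1.2)) (by fun_prop)
    exact contDiff_snd.add (h1.sub h2)
  have hderiv : ∀ z t, HasDerivAt (fun t => σ (z, t)) (1 + b (z.1 - α * z.2, z.2 + t)) t := by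
    intro z t
    have h1 : HasDerivAt (fun y => ∫ r in (0 : ℝ)..y, b (z.1 - α * z.2, r))
        (b (z.1 - α * z.2, z.2 + t)) (z.2 + t) :=
      intervalIntegral.integral_hasDerivAt_right (hbi _ _ _)
        ((hbc _).stronglyMeasurableAtFilter _ _) (hbc _).continuousAt
    exact (hasDerivAt_id t).add ((h1.comp_const_add z.2 t).sub_const
      (∫ r in (0 : ℝ)..z.2, b (z.1 - α * z.2, r)))
  have hpos : ∀ q, 0 < 1 + b q := fun q => by
    have := (abs_le.1 (hbound q)).1
    linarith
  -- Staying within `|t| / 2` of `t` forces `σ (z, ·)` to both infinities, hence surjectivity.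
  have hest : ∀ z t, |σ (z, t) - t| ≤ 1 / 2 * |t| := by
    intro z t
    rw [hσ_eq, add_sub_cancel_left]
    have := intervalIntegral.norm_integral_le_of_norm_le_const (a := z.2) (b := z.2 + t)
      (f := fun r => b (z.1 - α * z.2, r)) (C := 1 / 2) (fun r _ => hbound _)
    simpa using this
  have hbij : ∀ z, Function.Bijective fun t => σ (z, t) := by
    intro z
    have hc : Continuous fun t => σ (z, t) := hσ.continuous.comp (by fun_prop)
    refine ⟨(strictMono_of_deriv_pos fun t => ?_).injective, hc.surjective ?_ ?_⟩
    · rw [(hderiv z t).deriv]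
      exact hpos _
    · refine Filter.tendsto_atTop_mono' _ ?_
        (Filter.tendsto_id.const_mul_atTop (by norm_num : (0 : ℝ) < 1 / 2))
      filter_upwards [Filter.eventually_ge_atTop 0] with t ht
      have := (abs_le.1 (hest z t)).1
      rw [abs_of_nonneg ht] at this
      simp only [id]
      linarith
    · refine Filter.tendsto_atBot_mono' _ ?_
        (Filter.tendsto_id.const_mul_atBot (by norm_num : (0 : ℝ) < 1 / 2))
      filter_upwards [Filter.eventually_le_atBot 0] with t ht
      have := (abs_le.1 (hest z t)).2
      rw [abs_of_nonpos ht] at this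
      simp only [id]
      linarith
  have hadd : ∀ z s t, σ (z, s + t) = σ (z, s) + σ (leafShift α z s, t) := by
    intro z s t
    simp only [hσ_def, leafShift]
    rw [show z.1 + α * s - α * (z.2 + s) = z.1 - α * z.2 by ring, add_assoc z.2 s t]
    ring
  have hper : ∀ z z' t, torusPoint z = torusPoint z' → σ (z, t) = σ (z', t) := by
    rintro ⟨x, y⟩ ⟨x', y'⟩ t hz
    simp only [torusPoint, Prod.mk.injEq, circlePoint_eq_iff] at hz
    obtain ⟨⟨m, rfl⟩, n, rfl⟩ := hz
    rw [hσ_eq, hσ_eq]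
    dsimp only
    congr 1
    rw [show y' + n + t = y' + t + n by ring, ← intervalIntegral.integral_comp_add_right
      (fun r => b (x' + m - α * (y' + n), r)) (n : ℝ)]
    refine intervalIntegral.integral_congr fun r _ => ?_
    rw [show x' + m - α * (y' + n) = x' - α * y' + m - α * n by ring, hb2, hb1]
  obtain ⟨ψ, horb, hψ⟩ := exists_flow_of_transitionTime hσ
    (fun z t => by rw [(hderiv z t).deriv]; exact (hpos _).ne') hbij hadd hper
  refine ⟨ψ, σ, horb, hσ.continuous, fun x => ?_, hψ⟩
  rw [hσ_eq]
  simp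

/-- A conjugacy `F` displaces points along leaves by a continuous time, which `σ` turns into a
`ψ`-time `-u`. Comparing `F` at `(x, 0)` and `(x + α, 0)` through the relation at time `1` yields
the excluded cohomological equation with constant `A 1`. -/
theorem kroneckerFlow_not_isParameterRigid_of_irrational {α : ℝ} (hα : Irrational α)
    (hba : ¬ IsBadlyApproximable α) : ¬ (kroneckerFlow α).IsParameterRigid := by
  intro hrig
  obtain ⟨k, hkm, hkε⟩ := exists_liouville_sequence hα hba
  set ε : ℕ → ℝ := fun j => (k j : ℝ) * α - round ((k j : ℝ) * α) with hε_def
  have hk : ∀ j, 1 ≤ k j := fun j => (hkε j).1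
  have hε : ∀ j, |ε j| * (k j : ℝ) ^ j ≤ (1 / 2) ^ j / 32 := fun j => (hkε j).2
  have hεα : ∀ j, ∃ m : ℤ, ε j = k j * α - m := fun j => ⟨_, rfl⟩
  obtain ⟨ψ, σ, horb, hσ, hσ1, hψ⟩ := exists_flow_of_generator (α := α)
    (contDiff_liouvilleSeries hk hε) (abs_liouvilleSeries_le hk hε)
    (liouvilleSeries_add_intCast k ε) (liouvilleSeries_sub_add hεα)
  obtain ⟨hfree, -⟩ := exists_contDiff_transitionTime hα ψ horb
  obtain ⟨F, A, hF, hFA⟩ := hrig ψ horb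
  obtain ⟨β, hβ, hFβ⟩ := exists_continuous_leafwise_time (α := α)
    (H := fun z => F (torusPoint z)) (F.continuous.comp continuous_torusPoint)
    (B := id) continuous_id (by
      intro z
      have h1 : F (torusPoint z) ∈ (kroneckerFlow α).toFlow.orbit (torusPoint z) := by
        rw [← hF]
        exact ⟨_, (kroneckerFlow α).toFlow.mem_orbit_self _, rfl⟩
      obtain ⟨t, ht⟩ := h1
      exact ⟨t, ht.symm⟩)
  simp only [id] at hFβ
  set u : ℝ → ℝ := fun x => -σ ((x, 0), β (x, 0)) with hu_def
  have hu : Continuous u := (hσ.comp (by fun_prop)).neg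
  have hFu : ∀ x, F (torusPoint (x, 0)) = ψ.toFlow (-u x) (torusPoint (x, 0)) := by
    intro x
    rw [hFβ, hψ]
    simp [hu_def]
  have hup : Function.Periodic u 1 := by
    intro x
    have h1 : torusPoint (x + 1, 0) = torusPoint (x, 0) := by
      simp only [torusPoint, Prod.mk.injEq, and_true, circlePoint_eq_iff]
      exact ⟨1, by simp⟩
    have h2 := hFu (x + 1)
    rw [h1, hFu x] at h2
    linarith [ψ.toFlow.eq_of_apply_eq (hfree _) h2]
  refine no_continuous_transfer hα hkm hk hε hεα hu hup (c := A 1) fun x => ?_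
  have h1 : (kroneckerFlow α).toFlow 1 (torusPoint (x, 0)) = torusPoint (x + α, 0) := by
    rw [kroneckerFlow_torusPoint, torusPoint, torusPoint, Prod.mk.injEq, circlePoint_eq_iff,
      circlePoint_eq_iff]
    exact ⟨⟨0, by simp⟩, 1, by simp⟩
  have h2 := hFA (torusPoint (x, 0)) 1
  rw [h1, hFu, hFu, ← h1, hψ, ← ψ.toFlow.map_add, ← ψ.toFlow.map_add] at h2
  have h3 := ψ.toFlow.eq_of_apply_eq (hfree _) h2
  rw [← hσ1]
  linarith

theorem mainTheorem4 (α : ℝ) :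
    (kroneckerFlow α).IsParameterRigid ↔ IsBadlyApproximable α := by
  refine ⟨fun hrig => ?_, IsBadlyApproximable.isParameterRigid⟩
  by_contra hba
  by_cases hα : Irrational α
  · exact kroneckerFlow_not_isParameterRigid_of_irrational hα hba hrig
  · obtain ⟨q, rfl⟩ := not_not.1 hα
    refine kroneckerFlow_not_isParameterRigid_of_rational (k := q.den) (m := q.num)
      (by exact_mod_cast q.den_ne_zero) ?_ hrig
    exact_mod_cast Rat.den_mul_eq_num q
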